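/- Let $\mathcal{O}$ be a complete discrete valuation ring with uniformizer $\varepsilon$ and algebraically closed residue field $\kappa$, and let $A=\mathcal{O}[X,Y]/(X^2,Y^2)$. An $A$-lattice is an $A$-module that is free of finite rank over $\mathcal{O}$. A morphism $f$ of $A$-lattices is irreducible if it is neither a section nor a retraction and, for every factorization $f=f_2\circ f_1$ through an $A$-lattice, $f_1$ is a section or $f_2$ is a retraction. A short exact sequence $0\to L\xrightarrow{f} M\xrightarrow{g} N\to 0$ of $A$-lattices is an almost split sequence ending at $N$ if $f$ and $g$ are irreducible and $L$ and $N$ are indecomposable. Let $n\ge 1$. Let $M(\infty)_n$ be the $A$-module with $\kappa$-basis $u_1,\dots,u_n,v_1,\dots,v_n$ and $Yu_i=v_i$, $Xu_1=0$, $Xu_i=v_{i-1}$ $(i\ge 2)$, $Xv_i=Yv_i=0$, and let $Z_n^\infty$ be the kernel of the $A$-homomorphism $A^n\to M(\infty)_n$, $e_i\mapsto u_i$. In $Z_n^\infty$ put $b_{i,1}=\varepsilon e_i$ and $b_{i,4}=XYe_i$ for $1\le i\le n$; $b_{1,2}=Xe_1$ and $b_{i,2}=\varepsilon Xe_i$ for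 $2\le i\le n$; $b_{i,3}=Ye_i-Xe_{i+1}$ for $1\le i\le n-1$ and $b_{n,3}=\varepsilon Ye_n$. Let $\pi_{n,\infty}:A^{2n}\to Z_n^\infty$ be the $A$-homomorphism with $e_1\mapsto b_{1,1}$, $e_2\mapsto b_{1,2}$, $e_{2k+1}\mapsto b_{k,3}$ for $1\le k\le n-1$, and $e_{2k}\mapsto b_{k,1}$ for $2\le k\le n$. Then there is a unique $A$-endomorphism $\Phi_n^\infty$ of $Z_n^\infty$ with $\Phi_n^\infty(b_{n,1})=b_{n,4}$ and $\Phi_n^\infty(b_{k,1})=0$ for $k\ne n$; the map $\pi_{n,\infty}$ is surjective and its kernel is isomorphic to $Z_n^\infty$, so that there is an exact sequence $0\to Z_n^\infty\xrightarrow{\iota} A^{2n}\xrightarrow{\pi_{n,\infty}} Z_n^\infty\to 0$; and for every such $\iota$ the pull-back of this sequence along $\Phi_n^\infty$, $$0\to Z_n^\infty\to E_n^\infty\to Z_n^\infty\to 0,\qquad E_n^\infty=\{(p,z)\in A^{2n}\oplus Z_n^\infty \mid \pi_{n,\infty}(p)=\Phi_n^\infty(z)\},$$ whose first map is $z\mapsto(\iota(z),0)$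 and whose second map is $(p,z)\mapsto z$, is an almost split sequence ending at $Z_n^\infty$. -/

import Mathlib

open IsLocalRing

universe u

/-! ## Lattices over an order and almost split sequences -/

section Lattices

/-- An `A`-module `M` over an `O`-order `A` is a lattice if it is free of finite rank over `O`. -/
structure IsLattice (O M : Type*) [CommRing O] [AddCommGroup M] [Module O M] : Prop where
  free : Module.Free O M
  finite : Module.Finite O M

/-- `f` is a section (split monomorphism). -/
def IsSectionMap {A M N : Type*} [Ring A] [AddCommGroup M] [Module A M]
    [AddCommGroup N] [Module A N] (f : M →ₗ[A] N) : Prop :=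
  ∃ r : N →ₗ[A] M, r ∘ₗ f = LinearMap.id

/-- `f` is a retraction (split epimorphism). -/
def IsRetractionMap {A M N : Type*} [Ring A] [AddCommGroup M] [Module A M]
    [AddCommGroup N] [Module A N] (f : M →ₗ[A] N) : Prop :=
  ∃ s : N →ₗ[A] M, f ∘ₗ s = LinearMap.id

/-- `f` is irreducible in the category of `A`-lattices: it is neither a section nor a retraction,
and whenever it factors as `f₂ ∘ f₁` through an `A`-lattice, `f₁` is a section or `f₂` is a
retraction. -/
def IsIrreducibleInLatt (O : Type u) {A M N : Type u} [CommRing O] [Ring A] [Algebra O A]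
    [AddCommGroup M] [Module A M] [AddCommGroup N] [Module A N] (f : M →ₗ[A] N) : Prop :=
  ¬ IsSectionMap f ∧ ¬ IsRetractionMap f ∧
    ∀ (L : Type u) [AddCommGroup L] [Module O L] [Module A L] [IsScalarTower O A L],
      IsLattice O L → ∀ (f₁ : M →ₗ[A] L) (f₂ : L →ₗ[A] N), f = f₂ ∘ₗ f₁ →
        IsSectionMap f₁ ∨ IsRetractionMap f₂

/-- `M` is an indecomposable `A`-module: it is non-zero and is not the internal direct sum of two
non-zero submodules. (Submodules of a lattice over an order over a discrete valuation ring
are lattices, so for lattices this is indecomposability in the category of lattices.) -/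
def IsIndecomposableModule (A M : Type*) [Ring A] [AddCommGroup M] [Module A M] : Prop :=
  Nontrivial M ∧ ∀ P Q : Submodule A M, IsCompl P Q → P = ⊥ ∨ Q = ⊥

/-- `0 → L → M → N → 0` is an almost split sequence (ending at `N`) in the category of
`A`-lattices: a short exact sequence of `A`-lattices with irreducible maps `f` and `g` and
indecomposable end terms. -/
structure IsAlmostSplit (O A L M N : Type u) [CommRing O] [Ring A] [Algebra O A]
    [AddCommGroup L] [Module O L] [Module A L] [IsScalarTower O A L]
    [AddCommGroup M] [Module O M] [Module A M] [IsScalarTower O A M]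
    [AddCommGroup N] [Module O N] [Module A N] [IsScalarTower O A N]
    (f : L →ₗ[A] M) (g : M →ₗ[A] N) : Prop where
  lattice_left : IsLattice O L
  lattice_middle : IsLattice O M
  lattice_right : IsLattice O N
  injective : Function.Injective f
  exact : Function.Exact f g
  surjective : Function.Surjective g
  irreducible_left : IsIrreducibleInLatt O f
  irreducible_right : IsIrreducibleInLatt O g
  indecomposable_left : IsIndecomposableModule A L
  indecomposable_right : IsIndecomposableModule A N

end Lattices

/-! ## Pull-backs of short exact sequences of modules -/

section Pullback

variable {A K P Z W : Type*} [Ring A] [AddCommGroup K] [Module A K] [AddCommGroup P] [Module A P]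
  [AddCommGroup Z] [Module A Z] [AddCommGroup W] [Module A W]

/-- The pull-back `{(p, w) | π p = φ w}` of `π : P → Z` along `φ : W → Z`. -/
def pullback (π : P →ₗ[A] Z) (φ : W →ₗ[A] Z) : Submodule A (P × W) :=
  LinearMap.eqLocus (π ∘ₗ LinearMap.fst A P W) (φ ∘ₗ LinearMap.snd A P W)

/-- The projection from the pull-back to `W`. -/
def pullbackSnd (π : P →ₗ[A] Z) (φ : W →ₗ[A] Z) : pullback π φ →ₗ[A] W :=
  LinearMap.snd A P W ∘ₗ (pullback π φ).subtype

/-- The map from `K` to the pull-back induced by `ι : K → P` with `π ∘ ι = 0` and by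
`0 : K → W`. -/
def pullbackInl (π : P →ₗ[A] Z) (φ : W →ₗ[A] Z) (ι : K →ₗ[A] P) (h : π ∘ₗ ι = 0) :
    K →ₗ[A] pullback π φ :=
  LinearMap.codRestrict (pullback π φ) (LinearMap.prod ι 0) fun k => by
    have := LinearMap.congr_fun h k
    simpa [pullback] using this

end Pullback

/-! ## The symmetric Kronecker algebra -/

noncomputable section Kronecker

/-- The symmetric Kronecker algebra `A = O[X, Y] / (X², Y²)`. -/
def SymKronecker (O : Type u) [CommRing O] : Type u :=
  MvPolynomial (Fin 2) O ⧸
    (Ideal.span {MvPolynomial.X 0 ^ 2, MvPolynomial.X 1 ^ 2} : Ideal (MvPolynomial (Fin 2) O))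

instance (O : Type u) [CommRing O] : CommRing (SymKronecker O) :=
  inferInstanceAs (CommRing (MvPolynomial (Fin 2) O ⧸
    (Ideal.span {MvPolynomial.X 0 ^ 2, MvPolynomial.X 1 ^ 2} : Ideal (MvPolynomial (Fin 2) O))))

instance (O : Type u) [CommRing O] : Algebra O (SymKronecker O) :=
  inferInstanceAs (Algebra O (MvPolynomial (Fin 2) O ⧸
    (Ideal.span {MvPolynomial.X 0 ^ 2, MvPolynomial.X 1 ^ 2} : Ideal (MvPolynomial (Fin 2) O))))

namespace SymKronecker

variable (O : Type u) [CommRing O]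

/-- The class of `X` in `A`. -/
def X : SymKronecker O :=
  Ideal.Quotient.mk (Ideal.span {MvPolynomial.X 0 ^ 2, MvPolynomial.X 1 ^ 2}) (MvPolynomial.X 0)

/-- The class of `Y` in `A`. -/
def Y : SymKronecker O :=
  Ideal.Quotient.mk (Ideal.span {MvPolynomial.X 0 ^ 2, MvPolynomial.X 1 ^ 2}) (MvPolynomial.X 1)

/-- Evaluation of polynomials in two variables at a pair of commuting elements of a (not
necessarily commutative) `O`-algebra. -/
def evalPair {R : Type*} [Ring R] [Algebra O R] (S T : R) (h : Commute S T) :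
    MvPolynomial (Fin 2) O →ₐ[O] R :=
  AddMonoidAlgebra.lift O R (Fin 2 →₀ ℕ)
    { toFun := fun m => S ^ (m.toAdd 0) * T ^ (m.toAdd 1)
      map_one' := by simp
      map_mul' := fun a b => by
        simp only [toAdd_mul, Finsupp.add_apply, pow_add]
        exact (h.pow_pow _ _).mul_mul_mul_comm _ _ }

theorem evalPair_X0 {R : Type*} [Ring R] [Algebra O R] (S T : R) (h : Commute S T) :
    evalPair O S T h (MvPolynomial.X 0) = S := by
  have : evalPair O S T h (MvPolynomial.X 0) = (1 : O) • (S ^ _ * T ^ _) :=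
    AddMonoidAlgebra.lift_single _ _ _
  simpa using this

theorem evalPair_X1 {R : Type*} [Ring R] [Algebra O R] (S T : R) (h : Commute S T) :
    evalPair O S T h (MvPolynomial.X 1) = T := by
  have : evalPair O S T h (MvPolynomial.X 1) = (1 : O) • (S ^ _ * T ^ _) :=
    AddMonoidAlgebra.lift_single _ _ _
  simpa using this

/-- The algebra homomorphism `A → R` with `X ↦ S`, `Y ↦ T` given by commuting elements `S`, `T` of
square zero. -/
def liftPair {R : Type*} [Ring R] [Algebra O R] (S T : R) (h : Commute S T)
    (hS : S ^ 2 = 0) (hT : T ^ 2 = 0) : SymKronecker O →ₐ[O] R :=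
  Ideal.Quotient.liftₐ (Ideal.span {MvPolynomial.X 0 ^ 2, MvPolynomial.X 1 ^ 2})
    (evalPair O S T h) fun a ha => by
    have hle : Ideal.span {MvPolynomial.X 0 ^ 2, MvPolynomial.X 1 ^ 2} ≤
        RingHom.ker (evalPair O S T h) := by
      rw [Ideal.span_le]
      rintro x (rfl | rfl)
      · simp [RingHom.mem_ker, evalPair_X0, hS]
      · simp [RingHom.mem_ker, evalPair_X1, hT]
    exact hle ha

theorem liftPair_X {R : Type*} [Ring R] [Algebra O R] (S T : R) (h : Commute S T)
    (hS : S ^ 2 = 0) (hT : T ^ 2 = 0) : liftPair O S T h hS hT (X O) = S :=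
  evalPair_X0 O S T h

theorem liftPair_Y {R : Type*} [Ring R] [Algebra O R] (S T : R) (h : Commute S T)
    (hS : S ^ 2 = 0) (hT : T ^ 2 = 0) : liftPair O S T h hS hT (Y O) = T :=
  evalPair_X1 O S T h

end SymKronecker

open SymKronecker

/-! ## The modules `M(∞)_n` over the reduction of `A` -/

section MInfinity

/-- The nilpotent Jordan block `J(0, n)`, with ones on the superdiagonal. -/
def jordanZero (κ : Type*) [Field κ] (n : ℕ) : Matrix (Fin n) (Fin n) κ :=
  Matrix.of fun i j => if i.val + 1 = j.val then 1 else 0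

/-- The matrix of `X` on `M(∞)_n`. -/
def matX (κ : Type*) [Field κ] (n : ℕ) : Matrix (Fin n ⊕ Fin n) (Fin n ⊕ Fin n) κ :=
  Matrix.fromBlocks 0 0 (jordanZero κ n) 0

/-- The matrix of `Y` on `M(∞)_n`. -/
def matY (κ : Type*) [Field κ] (n : ℕ) : Matrix (Fin n ⊕ Fin n) (Fin n ⊕ Fin n) κ :=
  Matrix.fromBlocks 0 0 1 0

variable (O : Type u) [CommRing O] [IsLocalRing O] (n : ℕ)

theorem matX_matY_commute (κ : Type*) [Field κ] (n : ℕ) : Commute (matX κ n) (matY κ n) := by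
  simp [Commute, SemiconjBy, matX, matY, Matrix.fromBlocks_multiply]

theorem matX_sq (κ : Type*) [Field κ] (n : ℕ) : matX κ n ^ 2 = 0 := by
  simp [pow_two, matX, Matrix.fromBlocks_multiply]

theorem matY_sq (κ : Type*) [Field κ] (n : ℕ) : matY κ n ^ 2 = 0 := by
  simp [pow_two, matY, Matrix.fromBlocks_multiply]

/-- The representation of `A` on `κ²ⁿ` given by the two matrices above. -/
def matRep : SymKronecker O →ₐ[O] Matrix (Fin n ⊕ Fin n) (Fin n ⊕ Fin n) (ResidueField O) :=
  liftPair O (matX (ResidueField O) n) (matY (ResidueField O) n)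
    (matX_matY_commute _ n) (matX_sq _ n) (matY_sq _ n)

theorem matRep_X : matRep O n (X O) = matX (ResidueField O) n := liftPair_X _ _ _ _ _ _

theorem matRep_Y : matRep O n (Y O) = matY (ResidueField O) n := liftPair_Y _ _ _ _ _ _

/-- The `A`-module structure on `κ²ⁿ`: `a ∈ A` acts on column vectors by the matrix `matRep a`. -/
@[reducible] def matModule : Module (SymKronecker O) ((Fin n ⊕ Fin n) → ResidueField O) where
  smul a v := (matRep O n a).mulVec v
  one_smul v := by
    change (matRep O n 1).mulVec v = v
    rw [map_one, Matrix.one_mulVec]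
  mul_smul a b v := by
    change (matRep O n (a * b)).mulVec v = (matRep O n a).mulVec ((matRep O n b).mulVec v)
    rw [map_mul, Matrix.mulVec_mulVec]
  smul_zero a := Matrix.mulVec_zero _
  smul_add a v w := Matrix.mulVec_add _ v w
  add_smul a b v := by
    change (matRep O n (a + b)).mulVec v = (matRep O n a).mulVec v + (matRep O n b).mulVec v
    rw [map_add, Matrix.add_mulVec]
  zero_smul v := by
    change (matRep O n 0).mulVec v = 0
    rw [map_zero, Matrix.zero_mulVec]

/-- The module `M(∞)_n` with underlying space `κ²ⁿ`, with basis `u_1, …, u_n, v_1, …, v_n`, on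
which `X` and `Y` act by the matrices above. -/
def MInf : Type u := (Fin n ⊕ Fin n) → ResidueField O

instance : AddCommGroup (MInf O n) :=
  inferInstanceAs (AddCommGroup ((Fin n ⊕ Fin n) → ResidueField O))

instance : Module (SymKronecker O) (MInf O n) := matModule O n

/-- The basis vectors `u_1, …, u_n` (numbered from `0` here). -/
def uVec (i : Fin n) : MInf O n :=
  (Pi.single (Sum.inl i) 1 : (Fin n ⊕ Fin n) → ResidueField O)

/-- The basis vectors `v_1, …, v_n` (numbered from `0` here). -/
def vVec (i : Fin n) : MInf O n :=
  (Pi.single (Sum.inr i) 1 : (Fin n ⊕ Fin n) → ResidueField O)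

variable {O n}

theorem X_smul_uVec_zero (i : Fin n) (hi : i.val = 0) : X O • uVec O n i = 0 := by
  change (matRep O n (X O)).mulVec (Pi.single (Sum.inl i) 1) = 0
  rw [matRep_X, Matrix.mulVec_single_one]
  funext j
  rcases j with j | j <;> simp [matX, jordanZero, Matrix.col, hi]

theorem X_smul_uVec_succ (i j : Fin n) (h : i.val + 1 = j.val) :
    X O • uVec O n j = vVec O n i := by
  change (matRep O n (X O)).mulVec (Pi.single (Sum.inl j) 1) = Pi.single (Sum.inr i) 1
  rw [matRep_X, Matrix.mulVec_single_one]
  funext k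
  rcases k with k | k
  · simp [matX, Matrix.col]
  · simp [matX, jordanZero, Matrix.col, Pi.single_apply, ← h, Fin.ext_iff]

theorem Y_smul_uVec (i : Fin n) : Y O • uVec O n i = vVec O n i := by
  change (matRep O n (Y O)).mulVec (Pi.single (Sum.inl i) 1) = Pi.single (Sum.inr i) 1
  rw [matRep_Y, Matrix.mulVec_single_one]
  funext k
  rcases k with k | k
  · simp [matY, Matrix.col]
  · simp [matY, Matrix.col, Pi.single_apply, Matrix.one_apply]

theorem X_smul_vVec (i : Fin n) : X O • vVec O n i = 0 := by
  change (matRep O n (X O)).mulVec (Pi.single (Sum.inr i) 1) = 0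
  rw [matRep_X, Matrix.mulVec_single_one]
  funext j
  rcases j with j | j <;> simp [matX, Matrix.col]

theorem algebraMap_smul_MInf {r : O} (hr : r ∈ maximalIdeal O) (v : MInf O n) :
    algebraMap O (SymKronecker O) r • v = 0 := by
  have h : matRep O n (algebraMap O (SymKronecker O) r) = 0 := by
    rw [AlgHom.commutes, IsScalarTower.algebraMap_apply O (ResidueField O),
    ResidueField.algebraMap_eq, (residue_eq_zero_iff r).2 hr, map_zero]
  exact (congrArg (fun B => Matrix.mulVec B (v : (Fin n ⊕ Fin n) → ResidueField O)) h).trans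
    (Matrix.zero_mulVec _)

end MInfinity

/-! ## The Heller lattices `Z_n^∞` -/

section Heller

variable (O : Type u) [CommRing O] [IsLocalRing O] (n : ℕ)

/-- The projective cover `Aⁿ → M(∞)_n`, `e_i ↦ u_i`. -/
def coverMInf : (Fin n → SymKronecker O) →ₗ[SymKronecker O] MInf O n :=
  Fintype.linearCombination (SymKronecker O) (uVec O n)

/-- The Heller lattice `Z_n^∞`, the kernel of `Aⁿ → M(∞)_n`. -/
def ZInf : Submodule (SymKronecker O) (Fin n → SymKronecker O) :=
  LinearMap.ker (coverMInf O n)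

variable {O n}

/-- The element `a e_i` of `Aⁿ`. -/
abbrev smulE (a : SymKronecker O) (i : Fin n) : Fin n → SymKronecker O := Pi.single i a

theorem coverMInf_smulE (a : SymKronecker O) (i : Fin n) :
    coverMInf O n (smulE a i) = a • uVec O n i := by
  simp [coverMInf, smulE, Fintype.linearCombination_apply_single]

variable (ε : O)

theorem mem_maximalIdeal_of_irreducible {ε : O} (hε : Irreducible ε) : ε ∈ maximalIdeal O :=
  (mem_maximalIdeal ε).2 hε.not_isUnit

/-- The uniformizer as an element of `A`. -/
abbrev epsA : SymKronecker O := algebraMap O (SymKronecker O) ε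

/-- The element `b_{i,1} = ε e_i` of `Z_n^∞` (`i` is numbered from `0`). -/
def b1 (hε : Irreducible ε) (i : Fin n) : ZInf O n :=
  ⟨smulE (epsA ε) i, by
    rw [ZInf, LinearMap.mem_ker, coverMInf_smulE, algebraMap_smul_MInf (mem_maximalIdeal_of_irreducible hε)]⟩

/-- The element `b_{i,2}` of `Z_n^∞`: `X e_1` for the first index and `ε X e_i` otherwise. -/
def b2 (hε : Irreducible ε) (i : Fin n) : ZInf O n :=
  ⟨if i.val = 0 then smulE (X O) i else smulE (epsA ε * X O) i, by
    rw [ZInf, LinearMap.mem_ker]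
    split_ifs with h
    · rw [coverMInf_smulE, X_smul_uVec_zero i h]
    · rw [coverMInf_smulE, mul_smul, algebraMap_smul_MInf (mem_maximalIdeal_of_irreducible hε)]⟩

/-- The element `b_{i,3}` of `Z_n^∞`: `ε Y e_n` for the last index and `Y e_i - X e_{i+1}`
otherwise. -/
def b3 (hε : Irreducible ε) (i : Fin n) : ZInf O n :=
  ⟨if h : i.val + 1 < n then smulE (Y O) i - smulE (X O) ⟨i.val + 1, h⟩
    else smulE (epsA ε * Y O) i, by
    rw [ZInf, LinearMap.mem_ker]
    split_ifs with h
    · rw [map_sub, coverMInf_smulE, coverMInf_smulE, Y_smul_uVec,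
        X_smul_uVec_succ i ⟨i.val + 1, h⟩ rfl, sub_self]
    · rw [coverMInf_smulE, mul_smul, algebraMap_smul_MInf (mem_maximalIdeal_of_irreducible hε)]⟩

/-- The element `b_{i,4} = X Y e_i` of `Z_n^∞`. -/
def b4 (i : Fin n) : ZInf O n :=
  ⟨smulE (X O * Y O) i, by
    rw [ZInf, LinearMap.mem_ker, coverMInf_smulE, mul_smul, Y_smul_uVec, X_smul_vVec]⟩

/-- The images of the standard basis under `π_{n,∞}`. With all indices numbered from `1`:
`e_1 ↦ b_{1,1}`, `e_2 ↦ b_{1,2}`, `e_{2k+1} ↦ b_{k,3}` for `1 ≤ k ≤ n - 1` and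
`e_{2k} ↦ b_{k,1}` for `2 ≤ k ≤ n`. -/
def piInfGen (hε : Irreducible ε) (i : Fin (2 * n)) : ZInf O n :=
  if i.val = 0 then b1 ε hε ⟨0, by have := i.isLt; omega⟩
  else if i.val = 1 then b2 ε hε ⟨0, by have := i.isLt; omega⟩
  else if i.val % 2 = 0 then b3 ε hε ⟨i.val / 2 - 1, by omega⟩
  else b1 ε hε ⟨i.val / 2, by omega⟩

/-- The homomorphism `π_{n,∞} : A²ⁿ → Z_n^∞`. -/
def piInf (hε : Irreducible ε) :
    (Fin (2 * n) → SymKronecker O) →ₗ[SymKronecker O] ZInf O n :=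
  Fintype.linearCombination (SymKronecker O) (piInfGen ε hε)

/-- The property characterising the endomorphism `Φ_n^∞` of `Z_n^∞`: it maps `b_{n,1}` to
`b_{n,4}` and `b_{k,1}` to `0` for `k ≠ n`. -/
def IsPhiInf (hε : Irreducible ε)
    (Φ : ZInf O n →ₗ[SymKronecker O] ZInf O n) : Prop :=
  ∀ k : Fin n, Φ (b1 ε hε k) = if k.val + 1 = n then b4 k else 0

end Heller

end Kronecker

/-! ## A criterion for almost split sequences -/

section Criterion

/-! A short exact sequence of lattices ending at Z is almost split once three things are known: its
end terms have local endomorphism rings, it does not split, and every map L → Z that is not a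
retraction factors through its right-hand map. The first two make that map right minimal and the
left-hand map left minimal; a push-out turns the third property into its dual for maps out of the
left-hand term. Irreducibility of both maps follows (`isIrreducibleInLatt_right`,
`isIrreducibleInLatt_left`). For a pull-back of π along Φ, the last two conditions say that Φ itself
does not lift through π, while Φ ∘ h does for every non-retraction h : L → Z.

Local endomorphism ring. To ρ ∈ End Z attach the matrix m i j = ε⁻¹ c₀ (ρ b_{i,1})_j. The element Y
e_{i-1} - X e_i lies in Z and its ε-multiple is Y b_{i-1,1} - X b_{i,1}, so its image under ρ is
determined by m up to XY coordinates. That this image lies in Z forces m modulo ε to be triangular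
and constant along diagonals (`dvd_prv_sub_nxt`). If the diagonal is a unit, ρ is onto modulo the
radical, hence bijective by Nakayama (`bijective_of_not_dvd`); otherwise the same applies to 1 - ρ.

Lifting Φ ∘ h. If h is not a retraction, no h ∘ g with g : Z → L is bijective, so ε divides the last
diagonal entry of every h ∘ g. Dividing by ε gives an O-linear functional on Hom_A(Z, L). Evaluation
at generators embeds this Hom purely in L²ⁿ, so the functional extends to L²ⁿ, and the symmetrizing
form `cXY` of A converts its components L → O into A-linear maps L → A. These form the lift
(`exists_lift_phi`).

Φ does not lift. Comparing XY coordinates in a hypothetical lift gives congruences modulo ε along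
the diagonal which start at 0 and end at a unit (`not_exists_lift_phi`).

The kernel of π is found from the formula π(p)_i = ε α_i + Y β_{i+1} - X β_i: a kernel element is
determined by β, and β with alternating signs runs through Z. -/

theorem LinearMap.exists_lift_of_injective {A K E M : Type*} [Ring A] [AddCommGroup K] [Module A K]
    [AddCommGroup E] [Module A E] [AddCommGroup M] [Module A M] {f : K →ₗ[A] E}
    (hf : Function.Injective f) (u : M →ₗ[A] E) (hu : ∀ m, ∃ k, f k = u m) :
    ∃ d : M →ₗ[A] K, ∀ m, f (d m) = u m := by
  refine ⟨(LinearEquiv.ofInjective f hf).symm.toLinearMap ∘ₗ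
    u.codRestrict (LinearMap.range f) hu, fun m => ?_⟩
  have := LinearEquiv.apply_symm_apply (LinearEquiv.ofInjective f hf)
    (u.codRestrict (LinearMap.range f) hu m)
  exact congrArg Subtype.val this

theorem LinearMap.exists_desc_of_surjective {A E W M : Type*} [Ring A] [AddCommGroup W] [Module A W]
    [AddCommGroup E] [Module A E] [AddCommGroup M] [Module A M] {g : E →ₗ[A] W}
    (hg : Function.Surjective g) (u : E →ₗ[A] M) (hu : ∀ x, g x = 0 → u x = 0) :
    ∃ d : W →ₗ[A] M, ∀ x, d (g x) = u x := by
  refine ⟨(LinearMap.ker g).liftQ u hu ∘ₗ (g.quotKerEquivOfSurjective hg).symm.toLinearMap,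
    fun x => ?_⟩
  have h : (g.quotKerEquivOfSurjective hg).symm (g x) = (LinearMap.ker g).mkQ x := by
    rw [LinearEquiv.symm_apply_eq]
    rfl
  simp only [LinearMap.comp_apply, LinearEquiv.coe_coe, h]
  rfl

/-- Every endomorphism `u` of `M` is bijective or has `1 - u` bijective, so that `End M` is local
if `M` is non-zero. -/
def HasLocalEnd (A M : Type*) [Ring A] [AddCommGroup M] [Module A M] : Prop :=
  ∀ u : M →ₗ[A] M, Function.Bijective u ∨ Function.Bijective ((LinearMap.id : M →ₗ[A] M) - u)

theorem exists_inverse_of_bijective {A M N : Type*} [Ring A] [AddCommGroup M] [Module A M]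
    [AddCommGroup N] [Module A N] {u : M →ₗ[A] N} (hu : Function.Bijective u) :
    ∃ v : N →ₗ[A] M, (∀ m, v (u m) = m) ∧ ∀ m, u (v m) = m :=
  ⟨(LinearEquiv.ofBijective u hu).symm.toLinearMap,
    fun m => (LinearEquiv.ofBijective u hu).symm_apply_apply m,
    fun m => (LinearEquiv.ofBijective u hu).apply_symm_apply m⟩

/-- Of a projection and its complement one is bijective, so its kernel, a summand, is zero. -/
theorem HasLocalEnd.isIndecomposableModule {A M : Type*} [Ring A] [AddCommGroup M] [Module A M]
    [Nontrivial M] (h : HasLocalEnd A M) : IsIndecomposableModule A M := by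
  refine ⟨inferInstance, fun P Q hPQ => ?_⟩
  rcases h (P.projection Q hPQ) with h | h
  · right
    rw [eq_bot_iff]
    intro x hx
    have : P.projection Q hPQ x = 0 := by simpa using hx
    exact h.1 (by simpa using this)
  · left
    rw [eq_bot_iff]
    intro x hx
    have : P.projection Q hPQ x = x := by simpa using hx
    exact h.1 (by simp [this])

variable {A K E W : Type*} [Ring A] [AddCommGroup K] [Module A K] [AddCommGroup E] [Module A E]
  [AddCommGroup W] [Module A W] {f : K →ₗ[A] E} {g : E →ₗ[A] W}

theorem not_isSectionMap_of_exact (hex : Function.Exact f g) (hf : Function.Injective f)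
    (hg : Function.Surjective g) (hns : ¬ IsRetractionMap g) : ¬ IsSectionMap f :=
  fun h => hns (((hex.split_tfae hf hg).out 1 0).1 h)

/-- A nonsplit epimorphism with kernel of local endomorphism ring is right minimal. -/
theorem bijective_of_comp_eq_left (hex : Function.Exact f g) (hf : Function.Injective f)
    (hns : ¬ IsSectionMap f) (hK : HasLocalEnd A K) (u : E →ₗ[A] E) (hu : ∀ x, g (u x) = g x) :
    Function.Bijective u := by
  -- Since `1 - u` lands in ker g, it equals `f ∘ d`. If `d ∘ f` were invertible, f would be a
  -- section; so `1 - d ∘ f` is, and this is what `u` induces on `K`. The five lemma concludes.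
  obtain ⟨d, hd⟩ := LinearMap.exists_lift_of_injective hf (LinearMap.id - u) fun m =>
    (hex _).1 (by simp [hu])
  simp only [LinearMap.sub_apply, LinearMap.id_apply] at hd
  rcases hK (d ∘ₗ f) with h | h
  · obtain ⟨v, hv, -⟩ := exists_inverse_of_bijective h
    exact absurd ⟨v ∘ₗ d, LinearMap.ext hv⟩ hns
  have hfu : ∀ k, f (((LinearMap.id : K →ₗ[A] K) - d ∘ₗ f) k) = u (f k) := fun k => by simp [hd]
  refine ⟨(injective_iff_map_eq_zero u).2 fun x hx => ?_, fun y => ?_⟩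
  · obtain ⟨k, rfl⟩ := (hex x).1 (by rw [← hu, hx, map_zero])
    rw [← hfu] at hx
    rw [h.1 (hf (hx.trans (map_zero f).symm) |>.trans (map_zero _).symm), map_zero]
  · obtain ⟨k, hk⟩ := (hex (y - u y)).1 (by simp [hu])
    obtain ⟨k', rfl⟩ := h.2 k
    exact ⟨y + f k', by rw [map_add, ← hfu, hk]; abel⟩

/-- A nonsplit monomorphism with cokernel of local endomorphism ring is left minimal. -/
theorem bijective_of_comp_eq_right (hex : Function.Exact f g) (hg : Function.Surjective g)
    (hns : ¬ IsRetractionMap g) (hW : HasLocalEnd A W) (u : E →ₗ[A] E) (hu : ∀ x, u (f x) = f x) :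
    Function.Bijective u := by
  -- Dually, `1 - u = d ∘ g`, and `u` induces `1 - g ∘ d` on `W`.
  obtain ⟨d, hd⟩ := LinearMap.exists_desc_of_surjective hg (LinearMap.id - u) fun x hx => by
    obtain ⟨k, rfl⟩ := (hex x).1 hx
    simp [hu]
  simp only [LinearMap.sub_apply, LinearMap.id_apply] at hd
  rcases hW (g ∘ₗ d) with h | h
  · obtain ⟨v, -, hv⟩ := exists_inverse_of_bijective h
    exact absurd ⟨d ∘ₗ v, LinearMap.ext hv⟩ hns
  have hgu : ∀ x, ((LinearMap.id : W →ₗ[A] W) - g ∘ₗ d) (g x) = g (u x) := fun x => by simp [hd]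
  refine ⟨(injective_iff_map_eq_zero u).2 fun x hx => ?_, fun y => ?_⟩
  · have hx0 : g x = 0 := h.1 (by rw [hgu, hx, map_zero, map_zero])
    obtain ⟨k, rfl⟩ := (hex x).1 hx0
    rw [← hu, hx]
  · obtain ⟨w, hw⟩ := h.2 (g y)
    obtain ⟨x, rfl⟩ := hg w
    obtain ⟨k, hk⟩ := (hex (y - u x)).1 (by rw [map_sub, ← hgu, hw, sub_self])
    exact ⟨x + f k, by rw [map_add, hu, hk]; abel⟩

end Criterion

/-! ### Irreducibility of both maps from the right almost split property -/

section CriterionLattices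

variable {O A K E W : Type u} [CommRing O] [Ring A] [Algebra O A]
  [AddCommGroup K] [Module A K] [AddCommGroup E] [Module A E] [AddCommGroup W] [Module A W]
  {f : K →ₗ[A] E} {g : E →ₗ[A] W}

variable (O g) in
/-- `g` is right almost split in the category of lattices, up to not being a retraction. -/
def FactorsNonRetractions : Prop :=
  ∀ (L : Type u) [AddCommGroup L] [Module O L] [Module A L] [IsScalarTower O A L],
    IsLattice O L → ∀ h : L →ₗ[A] W, ¬ IsRetractionMap h → ∃ h' : L →ₗ[A] E, ∀ x, g (h' x) = h x

/-- If `g = f₂ ∘ f₁` and `f₂` is not a retraction, `f₂` factors as `g ∘ h'`; then `h' ∘ f₁` is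
compatible with g, hence bijective by minimality, and `f₁` is a section. -/
theorem isIrreducibleInLatt_right (hex : Function.Exact f g) (hf : Function.Injective f)
    (hg : Function.Surjective g) [Nontrivial K] (hns : ¬ IsRetractionMap g)
    (hK : HasLocalEnd A K) (hfac : FactorsNonRetractions O g) : IsIrreducibleInLatt O g := by
  refine ⟨?_, hns, ?_⟩
  · rintro ⟨r, hr⟩
    obtain ⟨k, hk⟩ := exists_ne (0 : K)
    apply hk
    apply hf
    rw [map_zero, ← LinearMap.id_apply (R := A) (f k), ← hr, LinearMap.comp_apply,
      hex.apply_apply_eq_zero, map_zero]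
  · intro L _ _ _ _ hL f₁ f₂ h
    by_cases h₂ : IsRetractionMap f₂
    · exact Or.inr h₂
    obtain ⟨h', hh'⟩ := hfac L hL f₂ h₂
    obtain ⟨v, hv, -⟩ := exists_inverse_of_bijective <|
      bijective_of_comp_eq_left hex hf (not_isSectionMap_of_exact hex hf hg hns) hK (h' ∘ₗ f₁)
        fun x => by rw [LinearMap.comp_apply, hh', h, LinearMap.comp_apply]
    exact Or.inl ⟨v ∘ₗ h', LinearMap.ext hv⟩

variable [IsDomain O]

theorem isLattice_of_isTorsionFree [IsPrincipalIdealRing O] (M : Type*) [AddCommGroup M] [Module O M] [Module.Finite O M]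
    (h : ∀ (r : O) (m : M), r ≠ 0 → r • m = 0 → m = 0) : IsLattice O M := by
  have : Module.IsTorsionFree O M := .of_smul_eq_zero fun r m hr =>
    or_iff_not_imp_left.2 fun h0 => h r m h0 hr
  exact ⟨Module.free_of_finite_type_torsion_free', inferInstance⟩

theorem IsLattice.eq_zero_of_smul_eq_zero {M : Type*} [AddCommGroup M] [Module O M]
    (h : IsLattice O M) {r : O} {m : M} (hr : r ≠ 0) (hm : r • m = 0) : m = 0 := by
  have := h.free
  exact (smul_eq_zero_iff_right hr).1 hm

variable [IsPrincipalIdealRing O]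

/-- Left almost split property deduced from the right almost split one by a push-out. -/
theorem exists_factor_of_not_isSectionMap [Module O E] [IsScalarTower O A E] [Module O W]
    [IsScalarTower O A W] (hE : IsLattice O E) (hW' : IsLattice O W)
    (hex : Function.Exact f g) (hf : Function.Injective f)
    (hg : Function.Surjective g) (hns : ¬ IsRetractionMap g)
    (hK : HasLocalEnd A K) (hfac : FactorsNonRetractions O g)
    {L : Type u} [AddCommGroup L] [Module O L] [Module A L] [IsScalarTower O A L]
    (hL : IsLattice O L) (f₁ : K →ₗ[A] L) (hf₁ : ¬ IsSectionMap f₁) :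
    ∃ h : E →ₗ[A] L, ∀ k, h (f k) = f₁ k := by
  -- The quotient by `R` is the push-out of `f` and `f₁`; it is an extension of `W` by `L`.
  let R : Submodule A (L × E) := LinearMap.range (f₁.prod (-f))
  let inl : L →ₗ[A] (L × E) ⧸ R := R.mkQ ∘ₗ LinearMap.inl A L E
  let inr : E →ₗ[A] (L × E) ⧸ R := R.mkQ ∘ₗ LinearMap.inr A L E
  have hcomm : ∀ k, inl (f₁ k) = inr (f k) := fun k => by
    refine (Submodule.Quotient.eq R).2 ⟨k, ?_⟩
    simp
  have hle : R ≤ LinearMap.ker (g ∘ₗ LinearMap.snd A L E) := by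
    rintro _ ⟨k, rfl⟩
    simp [hex.apply_apply_eq_zero]
  let g' : (L × E) ⧸ R →ₗ[A] W := R.liftQ (g ∘ₗ LinearMap.snd A L E) hle
  have hg'r : ∀ x, g' (inr x) = g x := fun x => rfl
  have hg'l : ∀ x, g' (inl x) = 0 := fun x => by
    change g 0 = 0
    exact map_zero g
  have hinl : Function.Injective inl := by
    refine (injective_iff_map_eq_zero inl).2 fun x hx => ?_
    obtain ⟨k, hk⟩ := (Submodule.Quotient.mk_eq_zero R).1 hx
    have h2 : f k = 0 := by simpa using congrArg Prod.snd hk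
    have h1 : f₁ k = x := by simpa using congrArg Prod.fst hk
    rw [← h1, hf (h2.trans (map_zero f).symm), map_zero]
  have hdec : ∀ z, ∃ a b, z = inl a + inr b := fun z => by
    obtain ⟨⟨a, b⟩, rfl⟩ := R.mkQ_surjective z
    refine ⟨a, b, ?_⟩
    simp only [inl, inr, LinearMap.comp_apply, ← map_add]
    simp
  have hex' : Function.Exact inl g' := by
    refine fun z => ⟨fun hz => ?_, ?_⟩
    · obtain ⟨a, b, rfl⟩ := hdec z
      rw [map_add, hg'l, hg'r, zero_add] at hz
      obtain ⟨k, rfl⟩ := (hex b).1 hz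
      exact ⟨a + f₁ k, by rw [map_add, hcomm]⟩
    · rintro ⟨a, rfl⟩
      exact hg'l a
  have hg' : Function.Surjective g' := fun w => by
    obtain ⟨x, rfl⟩ := hg w
    exact ⟨inr x, rfl⟩
  -- An extension of torsion-free modules is torsion-free, so the push-out may be tested against
  -- `hfac`.
  have hlat : IsLattice O ((L × E) ⧸ R) := by
    have := hL.finite
    have := hE.finite
    have : Module.Finite O ((L × E) ⧸ R) :=
      Module.Finite.of_surjective (R.mkQ.restrictScalars O) R.mkQ_surjective
    refine isLattice_of_isTorsionFree _ fun r z hr hz => ?_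
    obtain ⟨a, rfl⟩ := (hex' z).1 <| hW'.eq_zero_of_smul_eq_zero hr <| by
      rw [← LinearMap.map_smul_of_tower, hz, map_zero]
    rw [← LinearMap.map_smul_of_tower] at hz
    rw [hL.eq_zero_of_smul_eq_zero hr (hinl (hz.trans (map_zero _).symm)), map_zero]
  -- If the pushed-out sequence splits, a retraction onto `L` restricted to `E` extends `f₁`.
  -- Otherwise `g'` factors through `g`, and the resulting endomorphism of `E` is bijective by
  -- minimality. It induces `q ∘ f₁` on `K`, which is then bijective and makes `f₁` a section.
  by_cases hr : IsRetractionMap g'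
  · obtain ⟨r, hr⟩ := ((hex'.split_tfae hinl hg').out 0 1).1 hr
    exact ⟨r ∘ₗ inr, fun k => by
      rw [LinearMap.comp_apply, ← hcomm]; exact LinearMap.congr_fun hr _⟩
  · obtain ⟨h', hh'⟩ := hfac _ hlat g' hr
    have hbij := bijective_of_comp_eq_left hex hf (not_isSectionMap_of_exact hex hf hg hns) hK
      (h' ∘ₗ inr) fun x => by rw [LinearMap.comp_apply, hh', hg'r]
    obtain ⟨q, hq⟩ := LinearMap.exists_lift_of_injective hf (h' ∘ₗ inl) fun x =>
      (hex _).1 (by rw [LinearMap.comp_apply, hh', hg'l])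
    have hqf : ∀ k, f ((q ∘ₗ f₁) k) = (h' ∘ₗ inr) (f k) := fun k => by
      rw [LinearMap.comp_apply, hq, LinearMap.comp_apply, hcomm]
      rfl
    have hqb : Function.Bijective (q ∘ₗ f₁) := by
      refine ⟨fun a b hab => hf (hbij.1 ?_), fun k => ?_⟩
      · rw [← hqf, ← hqf, hab]
      · obtain ⟨x, hx⟩ := hbij.2 (f k)
        obtain ⟨k', rfl⟩ := (hex x).1 <| by
          rw [← hg'r, ← hh', ← LinearMap.comp_apply h' inr, hx, hex.apply_apply_eq_zero]
        exact ⟨k', hf (by rw [hqf, hx])⟩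
    obtain ⟨v, hv, -⟩ := exists_inverse_of_bijective hqb
    exact absurd ⟨v ∘ₗ q, LinearMap.ext hv⟩ hf₁

theorem isIrreducibleInLatt_left [Module O E] [IsScalarTower O A E] [Module O W]
    [IsScalarTower O A W] (hE : IsLattice O E) (hW' : IsLattice O W)
    (hex : Function.Exact f g) (hf : Function.Injective f)
    (hg : Function.Surjective g) [Nontrivial W] (hns : ¬ IsRetractionMap g)
    (hK : HasLocalEnd A K) (hW : HasLocalEnd A W) (hfac : FactorsNonRetractions O g) :
    IsIrreducibleInLatt O f := by
  refine ⟨not_isSectionMap_of_exact hex hf hg hns, ?_, ?_⟩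
  · rintro ⟨s, hs⟩
    obtain ⟨w, hw⟩ := exists_ne (0 : W)
    obtain ⟨x, rfl⟩ := hg w
    apply hw
    rw [← LinearMap.id_apply (R := A) x, ← hs, LinearMap.comp_apply, hex.apply_apply_eq_zero]
  · intro L _ _ _ _ hL f₁ f₂ h
    by_cases h₁ : IsSectionMap f₁
    · exact Or.inl h₁
    obtain ⟨h', hh'⟩ :=
      exists_factor_of_not_isSectionMap hE hW' hex hf hg hns hK hfac hL f₁ h₁
    obtain ⟨v, -, hv⟩ := exists_inverse_of_bijective <|
      bijective_of_comp_eq_right hex hg hns hW (f₂ ∘ₗ h')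
        fun x => by rw [LinearMap.comp_apply, hh', h, LinearMap.comp_apply]
    exact Or.inr ⟨h' ∘ₗ v, LinearMap.ext hv⟩

end CriterionLattices

/-! ## Coordinates on the symmetric Kronecker algebra -/

section Coordinates

namespace SymKronecker

variable {O : Type u} [CommRing O]

variable (O) in
/-- The isomorphism of `A` with `O[X]/(X²) [Y]/(Y²)`. -/
noncomputable def toDual : SymKronecker O →ₐ[O] DualNumber (DualNumber O) :=
  liftPair O (TrivSqZeroExt.inl DualNumber.eps) DualNumber.eps
    (mul_comm (TrivSqZeroExt.inl DualNumber.eps : DualNumber (DualNumber O)) DualNumber.eps)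
    (by rw [pow_two, ← TrivSqZeroExt.inl_mul, DualNumber.eps_mul_eps, TrivSqZeroExt.inl_zero])
    (by rw [pow_two, DualNumber.eps_mul_eps])

theorem toDual_X : toDual O (X O) = TrivSqZeroExt.inl DualNumber.eps := liftPair_X _ _ _ _ _ _

theorem toDual_Y : toDual O (Y O) = DualNumber.eps := liftPair_Y _ _ _ _ _ _

/-- The coefficient of `1`. -/
noncomputable def c0 : SymKronecker O →ₗ[O] O where
  toFun a := (toDual O a).fst.fst
  map_add' a b := by simp
  map_smul' r a := by simp

/-- The coefficient of `X`. -/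
noncomputable def cX : SymKronecker O →ₗ[O] O where
  toFun a := (toDual O a).fst.snd
  map_add' a b := by simp
  map_smul' r a := by simp

/-- The coefficient of `Y`. -/
noncomputable def cY : SymKronecker O →ₗ[O] O where
  toFun a := (toDual O a).snd.fst
  map_add' a b := by simp
  map_smul' r a := by simp

/-- The coefficient of `XY`. -/
noncomputable def cXY : SymKronecker O →ₗ[O] O where
  toFun a := (toDual O a).snd.snd
  map_add' a b := by simp
  map_smul' r a := by simp

@[simp] theorem c0_mul (a b : SymKronecker O) : c0 (a * b) = c0 a * c0 b := by
  simp [c0]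

@[simp] theorem cX_mul (a b : SymKronecker O) : cX (a * b) = c0 a * cX b + cX a * c0 b := by
  simp [c0, cX]

@[simp] theorem cY_mul (a b : SymKronecker O) : cY (a * b) = c0 a * cY b + cY a * c0 b := by
  simp [c0, cY]

@[simp] theorem cXY_mul (a b : SymKronecker O) :
    cXY (a * b) = c0 a * cXY b + cX a * cY b + cY a * cX b + cXY a * c0 b := by
  simp [c0, cX, cY, cXY]; ring

@[simp] theorem c0_algebraMap (r : O) : c0 (algebraMap O (SymKronecker O) r) = r := by
  simp [c0, TrivSqZeroExt.algebraMap_eq_inl']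
@[simp] theorem cX_algebraMap (r : O) : cX (algebraMap O (SymKronecker O) r) = 0 := by
  simp [cX, TrivSqZeroExt.algebraMap_eq_inl']
@[simp] theorem cY_algebraMap (r : O) : cY (algebraMap O (SymKronecker O) r) = 0 := by
  simp [cY, TrivSqZeroExt.algebraMap_eq_inl']
@[simp] theorem cXY_algebraMap (r : O) : cXY (algebraMap O (SymKronecker O) r) = 0 := by
  simp [cXY, TrivSqZeroExt.algebraMap_eq_inl']

@[simp] theorem c0_one : c0 (1 : SymKronecker O) = 1 := by
  rw [← map_one (algebraMap O (SymKronecker O)), c0_algebraMap]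
@[simp] theorem cX_one : cX (1 : SymKronecker O) = 0 := by
  rw [← map_one (algebraMap O (SymKronecker O)), cX_algebraMap]
@[simp] theorem cY_one : cY (1 : SymKronecker O) = 0 := by
  rw [← map_one (algebraMap O (SymKronecker O)), cY_algebraMap]
@[simp] theorem cXY_one : cXY (1 : SymKronecker O) = 0 := by
  rw [← map_one (algebraMap O (SymKronecker O)), cXY_algebraMap]

@[simp] theorem c0_X : c0 (X O) = 0 := by simp [c0, toDual_X]
@[simp] theorem cX_X : cX (X O) = 1 := by simp [cX, toDual_X]
@[simp] theorem cY_X : cY (X O) = 0 := by simp [cY, toDual_X]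
@[simp] theorem cXY_X : cXY (X O) = 0 := by simp [cXY, toDual_X]
@[simp] theorem c0_Y : c0 (Y O) = 0 := by simp [c0, toDual_Y]
@[simp] theorem cX_Y : cX (Y O) = 0 := by simp [cX, toDual_Y]
@[simp] theorem cY_Y : cY (Y O) = 1 := by simp [cY, toDual_Y]
@[simp] theorem cXY_Y : cXY (Y O) = 0 := by simp [cXY, toDual_Y]

theorem X_mul_X : X O * X O = 0 := by
  rw [← pow_two]
  exact Ideal.Quotient.eq_zero_iff_mem.2 (Ideal.subset_span (by simp))

theorem Y_mul_Y : Y O * Y O = 0 := by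
  rw [← pow_two]
  exact Ideal.Quotient.eq_zero_iff_mem.2 (Ideal.subset_span (by simp))

/-- The element of `A` with given coordinates. -/
noncomputable def ofCoords (a b c d : O) : SymKronecker O :=
  a • 1 + b • X O + c • Y O + d • (X O * Y O)

@[simp] theorem c0_ofCoords (a b c d : O) : c0 (ofCoords a b c d) = a := by simp [ofCoords]
@[simp] theorem cX_ofCoords (a b c d : O) : cX (ofCoords a b c d) = b := by simp [ofCoords]
@[simp] theorem cY_ofCoords (a b c d : O) : cY (ofCoords a b c d) = c := by simp [ofCoords]
@[simp] theorem cXY_ofCoords (a b c d : O) : cXY (ofCoords a b c d) = d := by simp [ofCoords]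

theorem X_mul_ofCoords (a b c d : O) : ofCoords a b c d * X O = ofCoords 0 a 0 c := by
  simp only [ofCoords, zero_smul, add_mul, Algebra.smul_mul_assoc, one_mul, X_mul_X, smul_zero]
  rw [show X O * Y O * X O = (X O * X O) * Y O by ring, X_mul_X, mul_comm (Y O)]
  simp

theorem Y_mul_ofCoords (a b c d : O) : ofCoords a b c d * Y O = ofCoords 0 0 a b := by
  simp only [ofCoords, zero_smul, add_mul, Algebra.smul_mul_assoc, one_mul, Y_mul_Y, smul_zero]
  rw [show X O * Y O * Y O = X O * (Y O * Y O) by ring, Y_mul_Y]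
  simp

theorem exists_ofCoords (x : SymKronecker O) : ∃ a b c d : O, ofCoords a b c d = x := by
  obtain ⟨p, rfl⟩ : ∃ p : MvPolynomial (Fin 2) O,
    (Ideal.Quotient.mk (Ideal.span {MvPolynomial.X 0 ^ 2, MvPolynomial.X 1 ^ 2}) p :
      SymKronecker O) = x := Ideal.Quotient.mk_surjective x
  induction p using MvPolynomial.induction_on with
  | C r =>
    refine ⟨r, 0, 0, 0, ?_⟩
    simp only [ofCoords, zero_smul, add_zero, ← Algebra.algebraMap_eq_smul_one]
    rfl
  | add p q hp hq =>
    obtain ⟨a, b, c, d, h⟩ := hp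
    obtain ⟨a', b', c', d', h'⟩ := hq
    refine ⟨a + a', b + b', c + c', d + d', ?_⟩
    refine Eq.trans ?_ (congrArg₂ (· + ·) h h')
    simp only [ofCoords, add_smul]
    abel
  | mul_X p i hp =>
    obtain ⟨a, b, c, d, h⟩ := hp
    fin_cases i
    · exact ⟨_, _, _, _, (X_mul_ofCoords a b c d).symm.trans (congrArg (· * X O) h)⟩
    · exact ⟨_, _, _, _, (Y_mul_ofCoords a b c d).symm.trans (congrArg (· * Y O) h)⟩

theorem ofCoords_eq (x : SymKronecker O) : ofCoords (c0 x) (cX x) (cY x) (cXY x) = x := by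
  obtain ⟨a, b, c, d, rfl⟩ := exists_ofCoords x
  simp

theorem ext_coords {x y : SymKronecker O} (h0 : c0 x = c0 y) (hX : cX x = cX y) (hY : cY x = cY y)
    (hXY : cXY x = cXY y) : x = y := by
  rw [← ofCoords_eq x, ← ofCoords_eq y, h0, hX, hY, hXY]

/-- Nondegeneracy of the symmetrizing form `cXY`. -/
theorem eq_of_cXY_mul_eq {x y : SymKronecker O} (h : ∀ a, cXY (a * x) = cXY (a * y)) : x = y := by
  have h1 := h 1
  have hX := h (X O)
  have hY := h (Y O)
  have hXY := h (X O * Y O)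
  simp at h1 hX hY hXY
  exact ext_coords hXY hY hX h1

/-- `A` is free of rank four over `O`. -/
noncomputable def coordsEquiv : SymKronecker O ≃ₗ[O] O × O × O × O where
  toLinearMap := c0.prod (cX.prod (cY.prod cXY))
  invFun v := ofCoords v.1 v.2.1 v.2.2.1 v.2.2.2
  left_inv := ofCoords_eq
  right_inv v := by simp

instance : Module.Free O (SymKronecker O) := Module.Free.of_equiv coordsEquiv.symm

instance : Module.Finite O (SymKronecker O) := Module.Finite.equiv coordsEquiv.symm

/-! ### Functionals on a lattice as A-linear maps to A -/

section Frobenius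

variable {L : Type*} [AddCommGroup L] [Module O L] [Module (SymKronecker O) L]
  [IsScalarTower O (SymKronecker O) L]

theorem smul_eq_coords (a : SymKronecker O) (x : L) :
    a • x = c0 a • x + cX a • (X O • x) + cY a • (Y O • x) + cXY a • ((X O * Y O) • x) := by
  conv_lhs => rw [← ofCoords_eq a]
  simp only [ofCoords, add_smul, smul_assoc, one_smul]

/-- The `A`-linear map `L → A` corresponding to a functional `L → O` under the symmetrizing
form. -/
noncomputable def frobeniusLift (ν : L →ₗ[O] O) : L →ₗ[SymKronecker O] SymKronecker O where
  -- The coordinates are forced by `cXY (b * F x) = ν (b • x)` for b = XY, Y, X, 1: the basis dual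
  -- to 1, X, Y, XY is XY, Y, X, 1.
  toFun x := ofCoords (ν ((X O * Y O) • x)) (ν (Y O • x)) (ν (X O • x)) (ν x)
  map_add' x y := by
    simp only [ofCoords, smul_add, map_add, add_smul]
    abel
  map_smul' a x := by
    have e1 : Y O * X O = X O * Y O := mul_comm _ _
    have e2 : X O * (X O * Y O) = 0 := by rw [← mul_assoc, X_mul_X, zero_mul]
    have e3 : Y O * (X O * Y O) = 0 := by rw [mul_left_comm, Y_mul_Y, mul_zero]
    have e4 : X O * Y O * X O = 0 := by rw [mul_comm, e2]
    have e5 : X O * Y O * Y O = 0 := by rw [mul_comm, e3]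
    have e6 : X O * Y O * (X O * Y O) = 0 := by rw [mul_assoc, e3, mul_zero]
    have key : ∀ b : SymKronecker O, ν (b • a • x) = c0 a * ν (b • x) + cX a * ν ((b * X O) • x)
        + cY a * ν ((b * Y O) • x) + cXY a * ν ((b * (X O * Y O)) • x) := fun b => by
      rw [smul_eq_coords a x]
      simp only [smul_add, map_add, smul_comm b (c0 a), smul_comm b (cX a), smul_comm b (cY a),
        smul_comm b (cXY a), map_smul, smul_eq_mul, ← mul_smul]
    have key1 := key 1
    simp only [one_smul, one_mul] at key1
    apply ext_coords <;>
    simp [key, key1, X_mul_X, Y_mul_Y, e1, e2, e3, e4, e5, e6]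

theorem cXY_frobeniusLift (ν : L →ₗ[O] O) (x : L) : cXY (frobeniusLift ν x) = ν x :=
  cXY_ofCoords _ _ _ _

theorem cXY_mul_frobeniusLift (ν : L →ₗ[O] O) (a : SymKronecker O) (x : L) :
    cXY (a * frobeniusLift ν x) = ν (a • x) := by
  rw [← smul_eq_mul, ← map_smul, cXY_frobeniusLift]

end Frobenius

end SymKronecker

end Coordinates
open SymKronecker

/-! ## Coordinates on the Heller lattice and on `π` -/

section Shift

variable {α : Type*} [Zero α] {n : ℕ}

/-- The left shift of a finite sequence, filled up with zero. -/
def nxt (x : Fin n → α) (i : Fin n) : α := if h : i.val + 1 < n then x ⟨i.val + 1, h⟩ else 0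

/-- The right shift of a finite sequence, filled up with zero. -/
def prv (x : Fin n → α) (i : Fin n) : α := if 0 < i.val then x ⟨i.val - 1, by omega⟩ else 0

theorem map_nxt {β F : Type*} [Zero β] [FunLike F α β] [ZeroHomClass F α β] (f : F)
    (x : Fin n → α) (i : Fin n) : f (nxt x i) = nxt (fun j => f (x j)) i := by
  unfold nxt; split_ifs <;> simp

theorem map_prv {β F : Type*} [Zero β] [FunLike F α β] [ZeroHomClass F α β] (f : F)
    (x : Fin n → α) (i : Fin n) : f (prv x i) = prv (fun j => f (x j)) i := by
  unfold prv; split_ifs <;> simp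

theorem nxt_of_lt (x : Fin n → α) {i j : Fin n} (h : i.val + 1 = j.val) : nxt x i = x j := by
  have h' : i.val + 1 < n := by omega
  rw [nxt, dif_pos h']
  congr 1
  exact Fin.ext h

theorem nxt_last (x : Fin n → α) {i : Fin n} (h : i.val + 1 = n) : nxt x i = 0 := by
  rw [nxt, dif_neg (by omega)]

theorem prv_of_lt (x : Fin n → α) {i j : Fin n} (h : i.val + 1 = j.val) : prv x j = x i := by
  have h' : 0 < j.val := by omega
  rw [prv, if_pos h']
  congr 1
  exact Fin.ext (by simp [← h])

theorem prv_zero (x : Fin n → α) {i : Fin n} (h : i.val = 0) : prv x i = 0 := by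
  rw [prv, if_neg (by omega)]

end Shift

/-! ### Congruences describing the Heller lattice -/

section Membership

variable {O : Type u} [CommRing O] [IsLocalRing O] {n : ℕ}

theorem matRep_eq (a : SymKronecker O) :
    matRep O n a = c0 a • 1 + cX a • matX (ResidueField O) n + cY a • matY (ResidueField O) n := by
  conv_lhs => rw [← ofCoords_eq a]
  have h : matX (ResidueField O) n * matY (ResidueField O) n = 0 := by
    simp [matX, matY, Matrix.fromBlocks_multiply]
  simp [ofCoords, matRep_X, matRep_Y, h]

theorem smul_uVec_apply (a : SymKronecker O) (i : Fin n) (k : Fin n ⊕ Fin n) :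
    (a • uVec O n i) k = matRep O n a k (Sum.inl i) := by
  change (matRep O n a).mulVec (Pi.single (Sum.inl i) 1) k = _
  rw [Matrix.mulVec_single_one]
  rfl

theorem coverMInf_apply (z : Fin n → SymKronecker O) (k : Fin n ⊕ Fin n) :
    (coverMInf O n z) k = ∑ i, matRep O n (z i) k (Sum.inl i) := by
  simp only [← smul_uVec_apply, coverMInf, Fintype.linearCombination_apply]
  exact map_sum (Pi.evalAddMonoidHom (fun _ : Fin n ⊕ Fin n => ResidueField O) k)
    (fun i => z i • uVec O n i) Finset.univ

theorem smul_residue (r : O) (x : ResidueField O) : r • x = residue O r * x := by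
  rw [Algebra.smul_def, ResidueField.algebraMap_eq]

theorem coverMInf_apply_inl (z : Fin n → SymKronecker O) (j : Fin n) :
    (coverMInf O n z) (Sum.inl j) = residue O (c0 (z j)) := by
  rw [coverMInf_apply, Finset.sum_eq_single j]
  · simp [matRep_eq, matX, matY, smul_residue]
  · intro i _ hi
    simp [matRep_eq, matX, matY, hi.symm]
  · simp

theorem coverMInf_apply_inr (z : Fin n → SymKronecker O) (j : Fin n) :
    (coverMInf O n z) (Sum.inr j) = residue O (cY (z j) + cX (nxt z j)) := by
  rw [coverMInf_apply]
  simp only [matRep_eq, matX, matY, smul_residue, Matrix.add_apply, Matrix.smul_apply,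
    Matrix.fromBlocks_apply₂₁, Matrix.one_apply, Finset.sum_add_distrib, jordanZero, Matrix.of_apply]
  simp only [reduceCtorEq, if_false, mul_zero, Finset.sum_const_zero, zero_add, mul_ite, mul_one,
    Finset.sum_ite_eq, Finset.mem_univ, if_true, map_add]
  rw [add_comm]
  congr 1
  by_cases h : j.val + 1 < n
  · rw [nxt_of_lt z (j := ⟨j.val + 1, h⟩) rfl, Finset.sum_eq_single ⟨j.val + 1, h⟩]
    · simp
    · intro b _ hb
      rw [if_neg]
      exact fun h' => hb (Fin.ext h'.symm)
    · simp
  · rw [nxt_last z (by omega), map_zero, map_zero]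
    refine Finset.sum_eq_zero fun b _ => if_neg (by omega)

theorem mem_ZInf_iff_residue (z : Fin n → SymKronecker O) : z ∈ ZInf O n ↔
    ∀ j, residue O (c0 (z j)) = 0 ∧ residue O (cY (z j) + cX (nxt z j)) = 0 := by
  rw [ZInf, LinearMap.mem_ker]
  constructor
  · intro h j
    rw [← coverMInf_apply_inl, ← coverMInf_apply_inr, h]
    exact ⟨rfl, rfl⟩
  · intro h
    funext k
    rcases k with j | j
    · exact (coverMInf_apply_inl z j).trans (h j).1
    · exact (coverMInf_apply_inr z j).trans (h j).2

end Membership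

section Valuation

variable {O : Type u} [CommRing O] [IsDomain O] [IsDiscreteValuationRing O] {n : ℕ} {ε : O}

/-- These are the coefficients of u_j and v_j: the latter arises from Y u_j and from X u_{j+1}. The
X coordinate at the first index and all XY coordinates are unconstrained. -/
theorem mem_ZInf_iff (hε : Irreducible ε) (z : Fin n → SymKronecker O) : z ∈ ZInf O n ↔
    ∀ j, ε ∣ c0 (z j) ∧ ε ∣ cY (z j) + cX (nxt z j) := by
  rw [mem_ZInf_iff_residue]
  simp only [residue_eq_zero_iff, hε.maximalIdeal_eq, Ideal.mem_span_singleton]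

end Valuation

/-! ### A closed formula for π -/

section Coefficients

variable {O : Type u} [CommRing O] {n : ℕ}

/-- The coefficients of the generators `b_{i,1}` in `A²ⁿ`. -/
noncomputable def alphaCoeff : (Fin (2 * n) → SymKronecker O) →ₗ[SymKronecker O] (Fin n → SymKronecker O) where
  toFun p (i : Fin n) := if i.val = 0 then p ⟨0, by have := i.isLt; omega⟩ else p ⟨2 * i.val + 1, by omega⟩
  map_add' p q := by funext i; dsimp only [Pi.add_apply]; split_ifs <;> rfl
  map_smul' a p := by funext i; dsimp only [Pi.smul_apply, RingHom.id_apply]; split_ifs <;> rfl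

/-- The coefficients of the generators `-b_{1,2}, b_{1,3}, …, b_{n-1,3}` in `A²ⁿ`. -/
noncomputable def betaCoeff : (Fin (2 * n) → SymKronecker O) →ₗ[SymKronecker O] (Fin n → SymKronecker O) where
  -- The sign makes X e_1 fit the pattern Y e_{i-1} - X e_i with e_0 = 0.
  toFun p (i : Fin n) := if i.val = 0 then -p ⟨1, by have := i.isLt; omega⟩ else p ⟨2 * i.val, by omega⟩
  map_add' p q := by
    funext i; dsimp only [Pi.add_apply]; split_ifs
    · rw [neg_add]
    · rfl
  map_smul' a p := by
    funext i; dsimp only [Pi.smul_apply, RingHom.id_apply]; split_ifs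
    · rw [smul_neg]
    · rfl

/-- With `eq_zero_of_coeff`, this identifies A²ⁿ with pairs (α, β) in Aⁿ × Aⁿ. -/
theorem exists_coeff (α β : Fin n → SymKronecker O) :
    ∃ p : Fin (2 * n) → SymKronecker O, alphaCoeff p = α ∧ betaCoeff p = β := by
  refine ⟨fun j => if j.val = 0 then α ⟨0, by have := j.isLt; omega⟩ else if j.val = 1 then -β ⟨0, by have := j.isLt; omega⟩
    else if j.val % 2 = 0 then β ⟨j.val / 2, by omega⟩ else α ⟨j.val / 2, by omega⟩, ?_, ?_⟩
  · funext i
    by_cases h : i.val = 0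
    · simp only [alphaCoeff, LinearMap.coe_mk, AddHom.coe_mk, h, if_true]
      congr 1
      exact Fin.ext h.symm
    · simp only [alphaCoeff, LinearMap.coe_mk, AddHom.coe_mk, h, if_false]
      rw [if_neg (by omega), if_neg (by omega), if_neg (by omega)]
      congr 1
      exact Fin.ext (by simp only; omega)
  · funext i
    by_cases h : i.val = 0
    · simp only [betaCoeff, LinearMap.coe_mk, AddHom.coe_mk, h, if_true, one_ne_zero, if_false,
        neg_neg]
      congr 1
      exact Fin.ext h.symm
    · simp only [betaCoeff, LinearMap.coe_mk, AddHom.coe_mk, h, if_false]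
      rw [if_neg (by omega), if_neg (by omega), if_pos (by omega)]
      congr 1
      exact Fin.ext (by simp only; omega)

theorem eq_zero_of_coeff {p : Fin (2 * n) → SymKronecker O} (hα : alphaCoeff p = 0)
    (hβ : betaCoeff p = 0) : p = 0 := by
  funext j
  by_cases h0 : j.val = 0
  · have := congrFun hα ⟨0, by have := j.isLt; omega⟩
    simp only [alphaCoeff, LinearMap.coe_mk, AddHom.coe_mk, if_true] at this
    refine Eq.trans ?_ this
    congr 1
    exact Fin.ext h0
  by_cases h1 : j.val = 1
  · have := congrFun hβ ⟨0, by have := j.isLt; omega⟩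
    simp only [betaCoeff, LinearMap.coe_mk, AddHom.coe_mk, if_true] at this
    refine Eq.trans ?_ (neg_eq_zero.1 this)
    congr 1
    exact Fin.ext h1
  by_cases h2 : j.val % 2 = 0
  · have := congrFun hβ ⟨j.val / 2, by omega⟩
    simp only [betaCoeff, LinearMap.coe_mk, AddHom.coe_mk] at this
    rw [if_neg (by omega)] at this
    refine Eq.trans ?_ this
    congr 1
    exact Fin.ext (by simp only; omega)
  · have := congrFun hα ⟨j.val / 2, by omega⟩
    simp only [alphaCoeff, LinearMap.coe_mk, AddHom.coe_mk] at this
    rw [if_neg (by omega)] at this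
    refine Eq.trans ?_ this
    congr 1
    exact Fin.ext (by simp only; omega)

variable [IsLocalRing O] {ε : O}

theorem coe_b1 (hε : Irreducible ε) (k i : Fin n) :
    (b1 ε hε k : Fin n → SymKronecker O) i = if i = k then epsA ε else 0 := by
  simp [b1, Pi.single_apply]

theorem coe_b4 (k i : Fin n) :
    ((b4 k : ZInf O n) : Fin n → SymKronecker O) i = if i = k then X O * Y O else 0 := by
  simp [b4, Pi.single_apply]

theorem coe_piInfGen (hε : Irreducible ε) (j : Fin (2 * n)) (a : SymKronecker O) (i : Fin n) :
    a * (piInfGen ε hε j : Fin n → SymKronecker O) i =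
      epsA ε * alphaCoeff (Pi.single j a) i + Y O * nxt (betaCoeff (Pi.single j a)) i
        - X O * betaCoeff (Pi.single j a) i := by
  have hj := j.isLt
  have hi := i.isLt
  by_cases h0 : j.val = 0
  · have e : piInfGen ε hε j = b1 ε hε ⟨0, by omega⟩ := by simp [piInfGen, h0]
    simp only [e, coe_b1, alphaCoeff, betaCoeff, nxt, LinearMap.coe_mk, AddHom.coe_mk,
      Pi.single_apply, Fin.ext_iff]
    split_ifs <;> first | omega | contradiction | simp [mul_comm]
  by_cases h1 : j.val = 1
  · have e : (piInfGen ε hε j : Fin n → SymKronecker O) = smulE (X O) ⟨0, by omega⟩ := by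
      simp [piInfGen, b2, h1]
    simp only [e, alphaCoeff, betaCoeff, nxt, LinearMap.coe_mk, AddHom.coe_mk,
      Pi.single_apply, Fin.ext_iff]
    split_ifs <;> first | omega | contradiction | simp [mul_comm]
  by_cases h2 : j.val % 2 = 0
  · have e : (piInfGen ε hε j : Fin n → SymKronecker O) =
        smulE (Y O) ⟨j.val / 2 - 1, by omega⟩ - smulE (X O) ⟨j.val / 2, by omega⟩ := by
      have h4 : j.val / 2 - 1 + 1 = j.val / 2 := by omega
      simp only [piInfGen, b3, h0, h1, h2, h4, if_true, if_false]
      rw [dif_pos (by omega)]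
    simp only [e, alphaCoeff, betaCoeff, nxt, LinearMap.coe_mk, AddHom.coe_mk, Pi.sub_apply,
      Pi.single_apply, Fin.ext_iff]
    split_ifs <;> first | omega | contradiction | simp [mul_comm]
  · have e : piInfGen ε hε j = b1 ε hε ⟨j.val / 2, by omega⟩ := by simp [piInfGen, h0, h1, h2]
    simp only [e, coe_b1, alphaCoeff, betaCoeff, nxt, LinearMap.coe_mk, AddHom.coe_mk,
      Pi.single_apply, Fin.ext_iff]
    split_ifs <;> first | omega | contradiction | simp [mul_comm]

/-- Every generator is ε e_i or, up to sign, Y e_{i-1} - X e_i; so β_i enters coordinate i through X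
and coordinate i - 1 through Y. -/
theorem piInf_apply (hε : Irreducible ε) (p : Fin (2 * n) → SymKronecker O) (i : Fin n) :
    (piInf ε hε p : Fin n → SymKronecker O) i =
      epsA ε * alphaCoeff p i + Y O * nxt (betaCoeff p) i - X O * betaCoeff p i := by
  have key : ∀ q : Fin (2 * n) → SymKronecker O, (piInf ε hε q : Fin n → SymKronecker O) i =
      ∑ j, q j * (piInfGen ε hε j : Fin n → SymKronecker O) i := fun q => by
    simp [piInf, Fintype.linearCombination_apply]
  rw [key]
  simp only [coe_piInfGen, Finset.sum_add_distrib, Finset.sum_sub_distrib, ← Finset.mul_sum]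
  have h1 : ∑ j, alphaCoeff (Pi.single j (p j)) i = alphaCoeff p i := by
    rw [← Finset.sum_apply, ← map_sum, Finset.univ_sum_single]
  have h2 : ∀ i, ∑ j, betaCoeff (Pi.single j (p j)) i = betaCoeff p i := fun i => by
    rw [← Finset.sum_apply, ← map_sum, Finset.univ_sum_single]
  have h3 : ∑ j, nxt (betaCoeff (Pi.single j (p j))) i = nxt (betaCoeff p) i := by
    unfold nxt
    split_ifs
    · exact h2 _
    · simp
  rw [h1, h2, h3]

end Coefficients

/-! ## The endomorphism `Φ` and the sequence `0 → Z → A²ⁿ → Z → 0` -/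

/-- Division of a map by r: pointwise quotients are unique, hence linear. -/
theorem LinearMap.exists_smul_eq_of_forall {R M N : Type*} [CommRing R] [AddCommGroup M]
    [Module R M] [AddCommGroup N] [Module R N] {r : R} (hr : Function.Injective fun x : N => r • x)
    (f : M →ₗ[R] N) (hf : ∀ m, ∃ y, r • y = f m) : ∃ g : M →ₗ[R] N, ∀ m, r • g m = f m := by
  choose g hg using hf
  refine ⟨{ toFun := g, map_add' := fun x y => hr ?_, map_smul' := fun a x => hr ?_ }, hg⟩
  · simp [hg]
  · simp only [hg, map_smul, RingHom.id_apply, smul_comm r]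

section Sequence

variable {O : Type u} [CommRing O] [IsDomain O] {n : ℕ} {ε : O}

theorem epsA_mul_cancel {r : O} (hr : r ≠ 0) {a b : SymKronecker O}
    (h : epsA r * a = epsA r * b) : a = b := by
  have h0 := congrArg c0 h
  have hX := congrArg cX h
  have hY := congrArg cY h
  have hXY := congrArg cXY h
  simp [hr] at h0 hX hY hXY
  exact ext_coords h0 hX hY hXY

variable [IsDiscreteValuationRing O]

theorem ZInf_epsA_cancel {r : O} (hr : r ≠ 0) {z w : ZInf O n}
    (h : epsA r • z = epsA r • w) : z = w := by
  apply Subtype.ext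
  funext i
  exact epsA_mul_cancel hr (congrFun (congrArg Subtype.val h) i)

/-- X and Y annihilate XY e_l; this makes `phiInf` A-linear. -/
theorem smul_b4 (a : SymKronecker O) (l : Fin n) : a • (b4 l : ZInf O n) = c0 a • b4 l := by
  apply Subtype.ext
  funext i
  simp only [Submodule.coe_smul, Submodule.coe_smul_of_tower, Pi.smul_apply, coe_b4]
  split_ifs
  · apply ext_coords <;> simp
  · simp

theorem isLattice_ZInf : IsLattice O (ZInf O n) := by
  have : Module.Finite O (ZInf O n) :=
    inferInstanceAs (Module.Finite O ((ZInf O n).restrictScalars O))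
  refine isLattice_of_isTorsionFree _ fun r z hr hz => ZInf_epsA_cancel hr ?_
  rw [smul_zero, ← hz, algebraMap_smul]

variable (hε : Irreducible ε)
include hε

theorem dvd_c0 (z : ZInf O n) (i : Fin n) : ε ∣ c0 ((z : Fin n → SymKronecker O) i) :=
  ((mem_ZInf_iff hε _).1 z.2 i).1

theorem dvd_cY_add_cX (z : ZInf O n) (i : Fin n) :
    ε ∣ cY ((z : Fin n → SymKronecker O) i) + cX (nxt (z : Fin n → SymKronecker O) i) :=
  ((mem_ZInf_iff hε _).1 z.2 i).2

/-- The functional `ε⁻¹ c₀` at a given coordinate. -/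
theorem exists_c0Div (i : Fin n) :
    ∃ l : ZInf O n →ₗ[O] O, ∀ z, ε * l z = c0 ((z : Fin n → SymKronecker O) i) :=
  LinearMap.exists_smul_eq_of_forall (r := ε) (mul_right_injective₀ hε.ne_zero)
    (c0 ∘ₗ LinearMap.proj i ∘ₗ (ZInf O n).subtype.restrictScalars O) fun z => by
      obtain ⟨y, hy⟩ := dvd_c0 hε z i
      exact ⟨y, hy.symm⟩

/-- The functional `ε⁻¹ c₀` at a given coordinate. -/
noncomputable def c0Div (i : Fin n) : ZInf O n →ₗ[O] O := (exists_c0Div hε i).choose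

theorem mul_c0Div (i : Fin n) (z : ZInf O n) :
    ε * c0Div hε i z = c0 ((z : Fin n → SymKronecker O) i) := (exists_c0Div hε i).choose_spec z

theorem c0Div_eq_iff (i : Fin n) (z : ZInf O n) (r : O) :
    c0Div hε i z = r ↔ c0 ((z : Fin n → SymKronecker O) i) = ε * r := by
  rw [← mul_c0Div hε, mul_right_inj' hε.ne_zero]

theorem c0Div_smul (i : Fin n) (a : SymKronecker O) (z : ZInf O n) :
    c0Div hε i (a • z) = c0 a * c0Div hε i z := by
  rw [c0Div_eq_iff, mul_left_comm, mul_c0Div]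
  simp

theorem c0Div_b1 (i k : Fin n) : c0Div hε i (b1 ε hε k) = if i = k then 1 else 0 := by
  rw [c0Div_eq_iff, coe_b1]
  split_ifs <;> simp

/-- Since εZ lies in the span of the b_{k,1}, a map from Z to an ε-torsion-free module is determined
by its values on them; uniqueness of Φ rests on this. -/
theorem eps_smul_eq_sum (z : ZInf O n) :
    epsA ε • z = ∑ k, (z : Fin n → SymKronecker O) k • b1 ε hε k := by
  apply Subtype.ext
  funext i
  simp only [Submodule.coe_smul, Submodule.coe_sum, Finset.sum_apply, Pi.smul_apply, coe_b1]
  simp [mul_comm]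

theorem eps_smul_map_eq_sum {M : Type*} [AddCommGroup M] [Module (SymKronecker O) M]
    (f : ZInf O n →ₗ[SymKronecker O] M) (z : ZInf O n) :
    epsA ε • f z = ∑ k, (z : Fin n → SymKronecker O) k • f (b1 ε hε k) := by
  rw [← map_smul, eps_smul_eq_sum hε, map_sum]
  simp only [map_smul]

/-- The endomorphism `Φ`. -/
noncomputable def phiInf (l : Fin n) : ZInf O n →ₗ[SymKronecker O] ZInf O n where
  toFun z := c0Div hε l z • b4 l
  map_add' z w := by rw [map_add, add_smul]
  map_smul' a z := by
    rw [c0Div_smul, RingHom.id_apply, smul_comm, smul_b4, smul_smul, mul_comm]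

theorem isPhiInf_phiInf {l : Fin n} (hl : l.val + 1 = n) : IsPhiInf ε hε (phiInf hε l) := by
  intro k
  have h : l = k ↔ k.val + 1 = n := by rw [Fin.ext_iff]; omega
  change c0Div hε l (b1 ε hε k) • b4 l = _
  rw [c0Div_b1]
  by_cases hk : l = k
  · subst hk; simp [hl]
  · rw [if_neg hk, if_neg (mt h.2 hk), zero_smul]

theorem IsPhiInf.eq {Φ Ψ : ZInf O n →ₗ[SymKronecker O] ZInf O n} (hΦ : IsPhiInf ε hε Φ)
    (hΨ : IsPhiInf ε hε Ψ) : Φ = Ψ := by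
  ext1 z
  apply ZInf_epsA_cancel hε.ne_zero
  rw [eps_smul_map_eq_sum hε, eps_smul_map_eq_sum hε]
  exact Finset.sum_congr rfl fun k _ => by rw [hΦ, hΨ]

theorem surjective_piInf : Function.Surjective (piInf (n := n) ε hε) := by
  intro z
  choose a ha using dvd_c0 hε z
  choose d hd using dvd_cY_add_cX hε z
  -- The term -X β_i must produce the X and XY coordinates of z, which dictates β. Then Y β_{i+1}
  -- contributes -cX(z_{i+1}) Y, and ε α_i corrects the Y coordinate, by a multiple of ε because z
  -- lies in Z.
  obtain ⟨p, hα, hβ⟩ := exists_coeff (fun i => ofCoords (a i) 0 (d i) 0)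
    (fun i => ofCoords (-cX ((z : Fin n → SymKronecker O) i)) 0
      (-cXY ((z : Fin n → SymKronecker O) i)) 0)
  refine ⟨p, Subtype.ext (funext fun i => ?_)⟩
  rw [piInf_apply, hα, hβ]
  have h0 := ha i
  have h1 := hd i
  by_cases h : i.val + 1 < n
  · rw [nxt_of_lt _ (j := ⟨i.val + 1, h⟩) rfl] at h1 ⊢
    apply ext_coords
    · simp [h0]
    · simp
    · simp [← h1]
    · simp
  · rw [nxt_last _ (by omega)] at h1 ⊢
    apply ext_coords
    · simp [h0]
    · simp
    · simpa using h1.symm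
    · simp

/-- The sign-twisted coefficients of the generators `b_{i,3}`. -/
noncomputable def signedBeta :
    (Fin (2 * n) → SymKronecker O) →ₗ[SymKronecker O] (Fin n → SymKronecker O) :=
  LinearMap.pi fun i => (-1 : O) ^ i.val • (LinearMap.proj i ∘ₗ betaCoeff)

omit [IsDomain O] [IsDiscreteValuationRing O] hε in
theorem signedBeta_apply (p : Fin (2 * n) → SymKronecker O) (i : Fin n) :
    signedBeta p i = (-1 : O) ^ i.val • betaCoeff p i := rfl

omit [IsDomain O] [IsDiscreteValuationRing O] hε in
theorem nxt_sign_smul (x : Fin n → SymKronecker O) (i : Fin n) :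
    nxt (fun j => (-1 : O) ^ j.val • x j) i = -((-1 : O) ^ i.val • nxt x i) := by
  unfold nxt
  split_ifs
  · dsimp only
    rw [pow_succ, mul_neg_one, neg_smul]
  · simp

omit [IsDomain O] [IsDiscreteValuationRing O] hε in
theorem exists_epsA_mul_eq {a : SymKronecker O} (h0 : ε ∣ c0 a) (hX : ε ∣ cX a) (hY : ε ∣ cY a)
    (hXY : ε ∣ cXY a) : ∃ b, epsA ε * b = a := by
  obtain ⟨x, hx⟩ := h0
  obtain ⟨y, hy⟩ := hX
  obtain ⟨z, hz⟩ := hY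
  obtain ⟨w, hw⟩ := hXY
  exact ⟨ofCoords x y z w, ext_coords (by simp [hx]) (by simp [hy]) (by simp [hz]) (by simp [hw])⟩

theorem piInf_eq_zero_iff (p : Fin (2 * n) → SymKronecker O) : piInf ε hε p = 0 ↔
    ∀ i, epsA ε * alphaCoeff p i = X O * betaCoeff p i - Y O * nxt (betaCoeff p) i := by
  rw [← Subtype.coe_inj, funext_iff]
  refine forall_congr' fun i => ?_
  rw [piInf_apply, add_sub_assoc, ← neg_sub, ← sub_eq_add_neg]
  exact sub_eq_zero

/-- The X and XY coordinates of ε α_i = X β_i - Y β_{i+1} say that ε divides c₀(β_i) and cY(β_i) -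
cX(β_{i+1}); alternating signs turn the difference into the sum required in Z. -/
theorem signedBeta_mem {p : Fin (2 * n) → SymKronecker O} (hp : piInf ε hε p = 0) :
    signedBeta p ∈ ZInf O n := by
  rw [mem_ZInf_iff hε]
  intro i
  have h := (piInf_eq_zero_iff hε p).1 hp i
  have hX := congrArg cX h
  have hXY := congrArg cXY h
  simp at hX hXY
  constructor
  · rw [signedBeta_apply, map_smul, smul_eq_mul, ← hX]
    exact (dvd_mul_right _ _).mul_left _
  · have : signedBeta p = fun j => (-1 : O) ^ j.val • betaCoeff p j := rfl
    rw [this, nxt_sign_smul]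
    simp only [map_smul, map_neg, smul_eq_mul]
    rw [← sub_eq_add_neg, ← mul_sub, ← hXY]
    exact (dvd_mul_right _ _).mul_left _

/-- The kernel of `π` is isomorphic to `Z`. -/
theorem exists_kerEquiv : ∃ e : LinearMap.ker (piInf (n := n) ε hε) →ₗ[SymKronecker O] ZInf O n,
    Function.Bijective e := by
  refine ⟨(signedBeta ∘ₗ (LinearMap.ker (piInf (n := n) ε hε)).subtype).codRestrict _
    fun p => signedBeta_mem hε p.2, (injective_iff_map_eq_zero _).2 fun p hp => ?_, fun z => ?_⟩
  · have hβ : betaCoeff (p : Fin (2 * n) → SymKronecker O) = 0 := by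
      funext i
      have : (-1 : O) ^ i.val • betaCoeff (p : Fin (2 * n) → SymKronecker O) i = 0 :=
        congrFun (congrArg Subtype.val hp) i
      exact ((isUnit_one.neg.pow i.val : IsUnit ((-1 : O) ^ i.val)).smul_eq_zero).1 this
    have hα : alphaCoeff (p : Fin (2 * n) → SymKronecker O) = 0 := by
      funext i
      apply epsA_mul_cancel hε.ne_zero
      rw [(piInf_eq_zero_iff hε _).1 p.2 i, hβ]
      have : nxt (0 : Fin n → SymKronecker O) i = 0 := by simp [nxt]
      simp [this]
    exact Subtype.ext (eq_zero_of_coeff hα hβ)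
  -- Conversely, the congruences defining Z are exactly what makes X β_i - Y β_{i+1} divisible by ε,
  -- and the quotient is α_i.
  · have hα : ∀ i : Fin n, ∃ a, epsA ε * a =
        X O * (-1 : O) ^ i.val • (z : Fin n → SymKronecker O) i -
        Y O * nxt (fun j => (-1 : O) ^ j.val • (z : Fin n → SymKronecker O) j) i := by
      intro i
      rw [nxt_sign_smul]
      have h1 : ε ∣ c0 (nxt (z : Fin n → SymKronecker O) i) := by
        unfold nxt
        split_ifs
        · exact dvd_c0 hε z _
        · simp
      apply exists_epsA_mul_eq
      · simp
      · simpa using (dvd_c0 hε z i).mul_left _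
      · simpa using h1.mul_left _
      · have := (dvd_cY_add_cX hε z i).mul_left ((-1) ^ i.val)
        simpa [mul_add] using this
    choose α hα using hα
    obtain ⟨p, hpα, hpβ⟩ := exists_coeff α
      fun i => (-1 : O) ^ i.val • (z : Fin n → SymKronecker O) i
    have hp : piInf ε hε p = 0 := (piInf_eq_zero_iff hε p).2 fun i => by rw [hpα, hpβ, hα]
    refine ⟨⟨p, hp⟩, Subtype.ext (funext fun i => ?_)⟩
    change (-1 : O) ^ i.val • betaCoeff p i = _
    rw [hpβ, smul_smul, ← mul_pow]
    simp

theorem exists_exact_piInf : ∃ ι : ZInf O n →ₗ[SymKronecker O] (Fin (2 * n) → SymKronecker O),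
    Function.Injective ι ∧ Function.Exact ι (piInf ε hε) := by
  obtain ⟨e, he⟩ := exists_kerEquiv (n := n) hε
  obtain ⟨v, hv, hv'⟩ := exists_inverse_of_bijective he
  refine ⟨(LinearMap.ker (piInf (n := n) ε hε)).subtype ∘ₗ v, ?_, fun p => ⟨fun hp => ?_, ?_⟩⟩
  · exact Subtype.val_injective.comp (Function.LeftInverse.injective hv')
  · exact ⟨e ⟨p, hp⟩, congrArg Subtype.val (hv ⟨p, hp⟩)⟩
  · rintro ⟨z, rfl⟩
    exact (v z).2

end Sequence

/-! ## The endomorphism ring of `Z` -/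

/-- Elements related to elements of a submodule by a matrix that is triangular modulo `ε` with unit
diagonal lie in the submodule, if their `ε`-multiples do. -/
theorem mem_of_triangular {R M : Type*} [CommRing R] [AddCommGroup M] [Module R M] {n : ℕ} {ε : R}
    (N : Submodule R M) (x : Fin n → M) (r : Fin n → Fin n → R)
    (hx : ∀ i, ε • x i ∈ N) (hr : ∀ i j, i < j → ε ∣ r i j) (hu : ∀ i, IsUnit (r i i))
    (h : ∀ i, ∑ j, r i j • x j ∈ N) (i : Fin n) : x i ∈ N := by
  induction i using WellFoundedLT.induction with
  | _ i ih =>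
    have hi := h i
    -- Off the diagonal, terms with j < i lie in N by induction and those with j > i because they
    -- are multiples of ε • x j.
    rw [← Finset.add_sum_erase _ _ (Finset.mem_univ i), Submodule.add_mem_iff_left] at hi
    · exact (N.smul_mem_iff_of_isUnit (hu i)).1 hi
    · refine sum_mem fun j hj => ?_
      rcases lt_or_gt_of_ne (Finset.ne_of_mem_erase hj) with hij | hij
      · exact N.smul_mem _ (ih j hij)
      · obtain ⟨c, hc⟩ := hr i j hij
        rw [hc, mul_comm, mul_smul]
        exact N.smul_mem _ (hx j)

section Endomorphisms

variable {O : Type u} [CommRing O] [IsDomain O] [IsDiscreteValuationRing O] {n : ℕ} {ε : O}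
  (hε : Irreducible ε)

/-- The element `Y e_{i-1} - X e_i` of `Z`, where `e_0 = 0`. -/
noncomputable def bG (i : Fin n) : ZInf O n :=
  ⟨fun j => (if j.val + 1 = i.val then Y O else 0) - (if j = i then X O else 0), by
    obtain ⟨ε, hε⟩ := IsDiscreteValuationRing.exists_irreducible O
    refine (mem_ZInf_iff hε _).2 fun j => ⟨by split_ifs <;> simp, ?_⟩
    unfold nxt
    by_cases h : j.val + 1 < n
    · rw [dif_pos h]
      by_cases hj : j.val + 1 = i.val
      · have : j ≠ i := by rintro rfl; omega
        have h' : (⟨j.val + 1, h⟩ : Fin n) = i := Fin.ext hj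
        simp [this, hj]
      · have h' : (⟨j.val + 1, h⟩ : Fin n) ≠ i := fun h' => hj (congrArg Fin.val h')
        simp only [hj, h', if_false]
        split_ifs <;> simp
    · have h' : j.val + 1 ≠ i.val := by omega
      simp only [h, h', dif_neg, if_false, not_false_eq_true]
      split_ifs <;> simp⟩

theorem coe_bG (i j : Fin n) : ((bG i : ZInf O n) : Fin n → SymKronecker O) j =
    (if j.val + 1 = i.val then Y O else 0) - (if j = i then X O else 0) := rfl

theorem eps_smul_bG (i : Fin n) :
    epsA ε • (bG i : ZInf O n) = Y O • prv (b1 ε hε) i - X O • b1 ε hε i := by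
  apply Subtype.ext
  funext j
  have h : ((prv (b1 ε hε) i : ZInf O n) : Fin n → SymKronecker O) j =
      if j.val + 1 = i.val then epsA ε else 0 := by
    unfold prv
    split_ifs with h0 h1 h1
    · rw [coe_b1, if_pos (Fin.ext (by simp only; omega))]
    · rw [coe_b1, if_neg fun h' => h1 (by rw [h']; simp only; omega)]
    · omega
    · rfl
  change epsA ε * ((bG i : ZInf O n) : Fin n → SymKronecker O) j =
    Y O * ((prv (b1 ε hε) i : ZInf O n) : Fin n → SymKronecker O) j -
      X O * (b1 ε hε i : Fin n → SymKronecker O) j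
  rw [h, coe_bG, coe_b1]
  split_ifs <;> ring

theorem eps_smul_map_bG {M : Type*} [AddCommGroup M] [Module (SymKronecker O) M]
    (f : ZInf O n →ₗ[SymKronecker O] M) (i : Fin n) :
    epsA ε • f (bG i) = Y O • prv (fun k => f (b1 ε hε k)) i - X O • f (b1 ε hε i) := by
  rw [← map_smul, eps_smul_bG hε, map_sub, map_smul, map_smul, map_prv]

variable (ρ : ZInf O n →ₗ[SymKronecker O] ZInf O n)

include hε in
theorem c0_map_bG (i j : Fin n) : c0 ((ρ (bG i) : Fin n → SymKronecker O) j) = 0 := by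
  have h := congrArg (fun z : ZInf O n => c0 ((z : Fin n → SymKronecker O) j))
    (eps_smul_map_bG hε ρ i)
  simpa [hε.ne_zero] using h

/-- Compare X coordinates in ε ρ(Y e_{i-1} - X e_i) = Y ρ(b_{i-1,1}) - X ρ(b_{i,1}) and cancel ε. -/
theorem cX_map_bG (i j : Fin n) : cX ((ρ (bG i) : Fin n → SymKronecker O) j) =
    -c0Div hε j (ρ (b1 ε hε i)) := by
  have h := congrArg (fun z : ZInf O n => cX ((z : Fin n → SymKronecker O) j))
    (eps_smul_map_bG hε ρ i)
  apply mul_left_cancel₀ hε.ne_zero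
  rw [mul_neg, mul_c0Div]
  simpa using h

theorem cY_map_bG (i j : Fin n) : cY ((ρ (bG i) : Fin n → SymKronecker O) j) =
    prv (fun k => c0Div hε j (ρ (b1 ε hε k))) i := by
  have h := congrArg (fun z : ZInf O n => cY ((z : Fin n → SymKronecker O) j))
    (eps_smul_map_bG hε ρ i)
  apply mul_left_cancel₀ hε.ne_zero
  rw [← map_prv (c0Div hε j), mul_c0Div]
  simpa using h

/-- This is the Y–X congruence of Z for ρ(Y e_{i-1} - X e_i). With m i j = `c0Div hε j (ρ (b1 ε hε
i))` it reads m (i-1) j ≡ m i (j+1) modulo ε, out-of-range entries being 0. -/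
theorem dvd_prv_sub_nxt (i j : Fin n) : ε ∣ prv (fun k => c0Div hε j (ρ (b1 ε hε k))) i -
    nxt (fun k => c0Div hε k (ρ (b1 ε hε i))) j := by
  have h := dvd_cY_add_cX hε (ρ (bG i)) j
  rw [cY_map_bG hε, map_nxt] at h
  simp only [cX_map_bG hε] at h
  convert h using 1
  unfold nxt
  split_ifs <;> ring

/-- Descending along its diagonal, an entry with i < j leaves the matrix through row -1, where it is
0. -/
theorem dvd_of_lt (i j : Fin n) (hij : i < j) : ε ∣ c0Div hε j (ρ (b1 ε hε i)) := by
  obtain ⟨i, hi⟩ := i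
  induction i generalizing j with
  | zero =>
    have hj : (⟨j.val - 1, by omega⟩ : Fin n).val + 1 = j.val := by
      have : 0 < j.val := hij
      simp only; omega
    have h := dvd_prv_sub_nxt hε ρ ⟨0, hi⟩ ⟨j.val - 1, by omega⟩
    rw [prv_zero _ rfl, nxt_of_lt _ hj, zero_sub, dvd_neg] at h
    exact h
  | succ i ih =>
    have hij' : i + 1 < j.val := hij
    have hj : (⟨j.val - 1, by omega⟩ : Fin n).val + 1 = j.val := by simp only; omega
    have h := dvd_prv_sub_nxt hε ρ ⟨i + 1, hi⟩ ⟨j.val - 1, by omega⟩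
    rw [prv_of_lt _ (i := ⟨i, by omega⟩) rfl, nxt_of_lt _ hj] at h
    exact (dvd_sub_right (ih ⟨j.val - 1, by omega⟩ (by omega)
      (Fin.mk_lt_mk.2 (by omega)))).1 h

theorem dvd_diag_sub (i j : Fin n) :
    ε ∣ c0Div hε i (ρ (b1 ε hε i)) - c0Div hε j (ρ (b1 ε hε j)) := by
  have key : ∀ m (hm : m < n), ε ∣ c0Div hε ⟨m, hm⟩ (ρ (b1 ε hε ⟨m, hm⟩)) -
      c0Div hε ⟨0, by omega⟩ (ρ (b1 ε hε ⟨0, by omega⟩)) := by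
    intro m
    induction m with
    | zero => simp
    | succ m ih =>
      intro hm
      have h := dvd_prv_sub_nxt hε ρ ⟨m + 1, hm⟩ ⟨m, by omega⟩
      rw [prv_of_lt _ (i := ⟨m, by omega⟩) rfl, nxt_of_lt _ (j := ⟨m + 1, hm⟩) rfl] at h
      simpa using dvd_sub (ih (by omega)) h
  simpa using dvd_sub (key i i.2) (key j j.2)

variable (ε) in
/-- The ideal of `A` generated by `ε`, `X` and `Y`. -/
noncomputable def radIdeal : Ideal (SymKronecker O) := Ideal.span {epsA ε, X O, Y O}

omit [IsDomain O] [IsDiscreteValuationRing O] in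
theorem epsA_mem_radIdeal : epsA ε ∈ radIdeal ε := Ideal.subset_span (by simp)

omit [IsDomain O] [IsDiscreteValuationRing O] in
theorem X_mem_radIdeal : X O ∈ radIdeal ε := Ideal.subset_span (by simp)

omit [IsDomain O] [IsDiscreteValuationRing O] in
theorem Y_mem_radIdeal : Y O ∈ radIdeal ε := Ideal.subset_span (by simp)

include hε in
-- A is integral over the local ring O, so its maximal ideals contain ε; X and Y are nilpotent.
theorem radIdeal_le_jacobson : radIdeal ε ≤ (⊥ : Ideal (SymKronecker O)).jacobson := by
  refine le_sInf fun M hM => Ideal.span_le.2 ?_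
  have hmax := hM.2
  rintro a (rfl | rfl | rfl)
  · have h := Ideal.isMaximal_comap_of_isIntegral_of_isMaximal (R := O) M
    have h' : ε ∈ Ideal.comap (algebraMap O (SymKronecker O)) M := by
      rw [IsLocalRing.eq_maximalIdeal h]
      exact mem_maximalIdeal_of_irreducible hε
    exact h'
  · exact hmax.isPrime.mem_of_pow_mem 2 (by rw [pow_two, X_mul_X]; exact M.zero_mem)
  · exact hmax.isPrime.mem_of_pow_mem 2 (by rw [pow_two, Y_mul_Y]; exact M.zero_mem)

theorem smul_mem_rad {a : SymKronecker O} (ha : a ∈ radIdeal ε) (z : ZInf O n) :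
    a • z ∈ radIdeal ε • (⊤ : Submodule (SymKronecker O) (ZInf O n)) :=
  Submodule.smul_mem_smul ha trivial

theorem sum_bG_apply (a : Fin n → SymKronecker O) (j : Fin n) :
    ((∑ i, a i • bG i : ZInf O n) : Fin n → SymKronecker O) j =
      nxt a j * Y O - a j * X O := by
  simp only [Submodule.coe_sum, Finset.sum_apply, Submodule.coe_smul, Pi.smul_apply, coe_bG,
    smul_eq_mul, mul_sub, Finset.sum_sub_distrib, mul_ite, mul_zero]
  congr 1
  · by_cases h : j.val + 1 < n
    · rw [nxt_of_lt a (j := ⟨j.val + 1, h⟩) rfl, Finset.sum_eq_single ⟨j.val + 1, h⟩]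
      · simp
      · intro b _ hb
        exact if_neg fun h' => hb (Fin.ext h'.symm)
      · simp
    · rw [nxt_last a (by omega), zero_mul]
      exact Finset.sum_eq_zero fun b _ => if_neg (by omega)
  · simp

theorem sum_b1_apply (a : Fin n → SymKronecker O) (j : Fin n) :
    ((∑ i, a i • b1 ε hε i : ZInf O n) : Fin n → SymKronecker O) j = a j * epsA ε := by
  simp [Finset.sum_apply, Pi.smul_apply, coe_b1]

include hε in
theorem mem_rad_of_dvd (z : ZInf O n)
    (h0 : ∀ i, ε * ε ∣ c0 ((z : Fin n → SymKronecker O) i))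
    (hX : ∀ i, ε ∣ cX ((z : Fin n → SymKronecker O) i))
    (hY : ∀ i, ε ∣ cY ((z : Fin n → SymKronecker O) i)) :
    z ∈ radIdeal ε • (⊤ : Submodule (SymKronecker O) (ZInf O n)) := by
  choose a ha using h0
  choose x hx using hX
  choose y hy using hY
  -- XY coordinates need no divisibility: -Y (Y e_{i-1} - X e_i) = XY e_i already lies in the
  -- radical of Z.
  have key : z = ∑ i, (a i • epsA ε + x i • X O + y i • Y O) • b1 ε hε i +
      ∑ i, (-(cXY ((z : Fin n → SymKronecker O) i) • Y O)) • bG i := by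
    apply Subtype.ext
    funext j
    rw [Submodule.coe_add, Pi.add_apply, sum_b1_apply, sum_bG_apply]
    have hn : nxt (fun i => -(cXY ((z : Fin n → SymKronecker O) i) • Y O)) j * Y O = 0 := by
      unfold nxt
      split_ifs <;> simp [Y_mul_Y]
    rw [hn]
    apply ext_coords
    · simp [ha]; ring
    · simp [hx]; ring
    · simp [hy]; ring
    · simp
  rw [key]
  refine add_mem (sum_mem fun i _ => smul_mem_rad ?_ _) (sum_mem fun i _ => smul_mem_rad ?_ _)
  · exact add_mem (add_mem (Submodule.smul_of_tower_mem _ _ epsA_mem_radIdeal)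
      (Submodule.smul_of_tower_mem _ _ X_mem_radIdeal))
      (Submodule.smul_of_tower_mem _ _ Y_mem_radIdeal)
  · exact neg_mem (Submodule.smul_of_tower_mem _ _ Y_mem_radIdeal)

/-- Modulo the radical, `Z` is generated by the `b_{i,1}` and the `Y e_{i-1} - X e_i`. -/
theorem sub_mem_rad (z : ZInf O n) :
    z - (∑ i, algebraMap O (SymKronecker O) (c0Div hε i z) • b1 ε hε i +
      ∑ i, algebraMap O (SymKronecker O) (-cX ((z : Fin n → SymKronecker O) i)) • bG i) ∈
      radIdeal ε • (⊤ : Submodule (SymKronecker O) (ZInf O n)) := by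
  have hz : ∀ i, ((z - (∑ i, algebraMap O (SymKronecker O) (c0Div hε i z) • b1 ε hε i +
      ∑ i, algebraMap O (SymKronecker O) (-cX ((z : Fin n → SymKronecker O) i)) • bG i) :
      ZInf O n) : Fin n → SymKronecker O) i = (z : Fin n → SymKronecker O) i -
      (algebraMap O (SymKronecker O) (c0Div hε i z) * epsA ε +
      (-algebraMap O (SymKronecker O) (cX (nxt (z : Fin n → SymKronecker O) i)) * Y O
      + algebraMap O (SymKronecker O) (cX ((z : Fin n → SymKronecker O) i)) * X O)) := by
    intro i
    rw [Submodule.coe_sub, Pi.sub_apply, Submodule.coe_add, Pi.add_apply, sum_b1_apply,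
      sum_bG_apply, map_nxt]
    congr 2
    have : nxt (fun i => algebraMap O (SymKronecker O) (-cX ((z : Fin n → SymKronecker O) i))) i =
      -algebraMap O (SymKronecker O) (nxt (fun j => cX ((z : Fin n → SymKronecker O) j)) i) := by
      unfold nxt
      split_ifs <;> simp
    rw [this, map_neg]
    ring
  apply mem_rad_of_dvd hε
  · intro i
    rw [hz]
    simp [← mul_c0Div hε, mul_comm]
  · intro i
    rw [hz]
    simp
  · intro i
    rw [hz]
    simpa using dvd_cY_add_cX hε z i

/-- Modulo ε the matrix of ρ is triangular with constant unit diagonal, so ρ hits generators modulo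
the radical; Nakayama gives surjectivity, and a surjective endomorphism of a finite module is
injective. -/
theorem bijective_of_not_dvd (l : Fin n) (hl : ¬ ε ∣ c0Div hε l (ρ (b1 ε hε l))) :
    Function.Bijective ρ := by
  have hunit : ∀ i, IsUnit (c0Div hε i (ρ (b1 ε hε i))) := fun i => by
    by_contra h
    rw [← mem_nonunits_iff, ← mem_maximalIdeal, hε.maximalIdeal_eq,
      Ideal.mem_span_singleton] at h
    exact hl ((dvd_sub_right h).1 (dvd_diag_sub hε ρ i l))
  have hA : ∀ r : O, IsUnit r → IsUnit (algebraMap O (SymKronecker O) r) := fun r hr => hr.map _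
  set J := radIdeal ε • (⊤ : Submodule (SymKronecker O) (ZInf O n)) with hJ
  set N := LinearMap.range ρ ⊔ J with hN
  have hρN : ∀ z, ρ z ∈ N := fun z => Submodule.mem_sup_left ⟨z, rfl⟩
  have hJN : J ≤ N := le_sup_right
  -- These generators come first: ρ(bG i) has no b_{j,1} component modulo the radical, whereas
  -- ρ(b_{i,1}) involves both families. The same matrix governs both.
  have hG : ∀ i, (bG i : ZInf O n) ∈ N := by
    apply mem_of_triangular (ε := epsA ε) N bG
      fun i j => algebraMap O (SymKronecker O) (c0Div hε j (ρ (b1 ε hε i)))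
    · exact fun i => hJN (smul_mem_rad epsA_mem_radIdeal _)
    · exact fun i j hij => map_dvd _ (dvd_of_lt hε ρ i j hij)
    · exact fun i => hA _ (hunit i)
    · intro i
      have h := hJN (sub_mem_rad hε (ρ (bG i)))
      have h0 : ∀ j, c0Div hε j (ρ (bG i)) = 0 := fun j => by
        rw [c0Div_eq_iff, c0_map_bG hε, mul_zero]
      simp only [h0, cX_map_bG hε, neg_neg, map_zero, zero_smul, Finset.sum_const_zero,
        zero_add] at h
      exact (Submodule.sub_mem_iff_right _ (hρN _)).1 h
  have hb : ∀ i, b1 ε hε i ∈ N := by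
    apply mem_of_triangular (ε := epsA ε) N (b1 ε hε)
      fun i j => algebraMap O (SymKronecker O) (c0Div hε j (ρ (b1 ε hε i)))
    · exact fun i => hJN (smul_mem_rad epsA_mem_radIdeal _)
    · exact fun i j hij => map_dvd _ (dvd_of_lt hε ρ i j hij)
    · exact fun i => hA _ (hunit i)
    · intro i
      have h := (Submodule.sub_mem_iff_right _ (hρN _)).1 (hJN (sub_mem_rad hε (ρ (b1 ε hε i))))
      exact (Submodule.add_mem_iff_left _
        (sum_mem fun j _ => Submodule.smul_mem _ _ (hG j))).1 h
  have htop : (⊤ : Submodule (SymKronecker O) (ZInf O n)) ≤ LinearMap.range ρ ⊔ J := by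
    intro z _
    refine (Submodule.sub_mem_iff_left _ (add_mem
      (sum_mem fun j _ => Submodule.smul_mem _ _ (hb j))
      (sum_mem fun j _ => Submodule.smul_mem _ _ (hG j)))).1 (hJN (sub_mem_rad hε z))
  have := (isLattice_ZInf (O := O) (n := n)).finite
  have hfin : Module.Finite (SymKronecker O) (ZInf O n) := Module.Finite.of_restrictScalars_finite O _ _
  have hsurj : Function.Surjective ρ := LinearMap.range_eq_top.1 <| top_le_iff.1 <|
    Submodule.le_of_le_smul_of_le_jacobson_bot hfin.fg_top (radIdeal_le_jacobson hε) htop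
  exact ⟨OrzechProperty.injective_of_surjective_endomorphism ρ hsurj, hsurj⟩

theorem hasLocalEnd_ZInf (hn : 0 < n) : HasLocalEnd (SymKronecker O) (ZInf O n) := by
  obtain ⟨ε, hε⟩ := IsDiscreteValuationRing.exists_irreducible O
  intro u
  by_cases h : ε ∣ c0Div hε ⟨0, hn⟩ (u (b1 ε hε ⟨0, hn⟩))
  · right
    apply bijective_of_not_dvd hε _ ⟨0, hn⟩
    rw [LinearMap.sub_apply, map_sub, LinearMap.id_apply, c0Div_b1, if_pos rfl]
    exact fun h' => hε.not_isUnit (isUnit_of_dvd_one ((dvd_sub_left h).1 h'))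
  · exact Or.inl (bijective_of_not_dvd hε u _ h)

end Endomorphisms

/-! ## Factorization through `π` -/

/-- A linear map into a torsion-free module over a principal ideal domain has a retraction if it
is injective with pure image. -/
theorem exists_leftInverse_of_pure {O H V : Type*} [CommRing O] [IsDomain O]
    [IsPrincipalIdealRing O] [AddCommGroup H] [Module O H] [AddCommGroup V] [Module O V]
    [Module.Finite O V] (f : H →ₗ[O] V) (hf : Function.Injective f)
    (hpure : ∀ (r : O) (v : V) (x : H), r ≠ 0 → f x = r • v → ∃ y, f y = v) :
    ∃ s : V →ₗ[O] H, ∀ x, s (f x) = x := by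
  -- Purity of the image makes the quotient torsion-free, hence free, and the sequence splits.
  have hlat : IsLattice O (V ⧸ LinearMap.range f) := by
    refine isLattice_of_isTorsionFree _ fun r q hr hq => ?_
    obtain ⟨v, rfl⟩ := (LinearMap.range f).mkQ_surjective q
    obtain ⟨x, hx⟩ := (Submodule.Quotient.mk_eq_zero _).1 hq
    exact (Submodule.Quotient.mk_eq_zero _).2 (hpure r v x hr hx)
  have := hlat.free
  obtain ⟨t, ht⟩ := Module.projective_lifting_property (LinearMap.range f).mkQ LinearMap.id
    (LinearMap.range f).mkQ_surjective
  have hex : Function.Exact f (LinearMap.range f).mkQ :=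
    LinearMap.exact_iff.2 (Submodule.ker_mkQ _)
  have hsplit := (hex.split_tfae hf (LinearMap.range f).mkQ_surjective).out 0 1
  obtain ⟨s, hs⟩ := hsplit.1 ⟨t, ht⟩
  exact ⟨s, LinearMap.congr_fun hs⟩

section Factorization

variable {O : Type u} [CommRing O] [IsDomain O] [IsDiscreteValuationRing O] {n : ℕ} {ε : O}
  (hε : Irreducible ε)

theorem piInf_eq_sum (p : Fin (2 * n) → SymKronecker O) :
    piInf ε hε p = ∑ j, p j • piInfGen ε hε j := by
  simp [piInf, Fintype.linearCombination_apply]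

/-- Extend the functional g ↦ ε⁻¹ c0Div_l(h(g(b_{l,1}))) from Hom_A(Z, L) to L²ⁿ and dualize through
`cXY`. -/
theorem exists_lift_phi {L : Type*} [AddCommGroup L] [Module O L] [Module (SymKronecker O) L]
    [IsScalarTower O (SymKronecker O) L] (hL : IsLattice O L)
    (h : L →ₗ[SymKronecker O] ZInf O n) (l : Fin n)
    (hdvd : ∀ g : ZInf O n →ₗ[SymKronecker O] L, ε ∣ c0Div hε l (h (g (b1 ε hε l)))) :
    ∃ N : L →ₗ[SymKronecker O] (Fin (2 * n) → SymKronecker O),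
      ∀ x, piInf ε hε (N x) = phiInf hε l (h x) := by
  have := hL.finite
  let ev : (ZInf O n →ₗ[SymKronecker O] L) →ₗ[O] (Fin (2 * n) → L) :=
    { toFun := fun g j => g (piInfGen ε hε j)
      map_add' := fun _ _ => rfl
      map_smul' := fun _ _ => rfl }
  have hev : ∀ (g : ZInf O n →ₗ[SymKronecker O] L) p,
      g (piInf ε hε p) = ∑ j, p j • ev g j := fun g p => by
    rw [piInf_eq_sum, map_sum]
    simp only [map_smul]
    rfl
  have hinj : Function.Injective ev := by
    refine fun g g' hg => LinearMap.ext fun z => ?_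
    obtain ⟨p, rfl⟩ := surjective_piInf hε z
    rw [hev, hev, hg]
  -- If g takes values in rL on the generators it does so on Z, and g / r is again a homomorphism;
  -- so the image of `ev` is pure.
  obtain ⟨s, hs⟩ := exists_leftInverse_of_pure ev hinj <| by
    intro r v g hr hg
    obtain ⟨g', hg'⟩ := LinearMap.exists_smul_eq_of_forall (r := epsA r) (N := L)
      (fun x y hxy => by
        simp only [algebraMap_smul] at hxy
        exact sub_eq_zero.1 (hL.eq_zero_of_smul_eq_zero hr (by rw [smul_sub, hxy, sub_self])))
      g fun z => by
        obtain ⟨p, rfl⟩ := surjective_piInf hε z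
        refine ⟨∑ j, p j • v j, ?_⟩
        rw [hev, hg, algebraMap_smul, Finset.smul_sum]
        exact Finset.sum_congr rfl fun j _ => smul_comm _ _ _
    refine ⟨g', funext fun j => sub_eq_zero.1 (hL.eq_zero_of_smul_eq_zero hr ?_)⟩
    have h1 := hg' (piInfGen ε hε j)
    rw [algebraMap_smul] at h1
    have h2 : g (piInfGen ε hε j) = r • v j := congrFun hg j
    rw [smul_sub, sub_eq_zero, ← h2, ← h1]
    rfl
  obtain ⟨χ, hχ⟩ := LinearMap.exists_smul_eq_of_forall (r := ε) (mul_right_injective₀ hε.ne_zero)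
    ({ toFun := fun g => c0Div hε l (h (g (b1 ε hε l)))
       map_add' := fun g g' => by simp
       map_smul' := fun r g => by
        rw [LinearMap.smul_apply, LinearMap.map_smul_of_tower, map_smul, RingHom.id_apply] } :
      (ZInf O n →ₗ[SymKronecker O] L) →ₗ[O] O) fun g => by
      obtain ⟨y, hy⟩ := hdvd g
      exact ⟨y, hy.symm⟩
  simp only [LinearMap.coe_mk, AddHom.coe_mk, smul_eq_mul] at hχ
  refine ⟨LinearMap.pi fun j => frobeniusLift (χ ∘ₗ s ∘ₗ LinearMap.single O (fun _ => L) j),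
    fun x => Subtype.ext (funext fun i => eq_of_cXY_mul_eq fun a => ?_)⟩
  -- By nondegeneracy it suffices to apply cXY(a · -) to coordinate i. Both sides then equal `χ g`
  -- for the map g sending z to z_i a x.
  let g : ZInf O n →ₗ[SymKronecker O] L :=
    LinearMap.toSpanSingleton (SymKronecker O) L (a • x) ∘ₗ LinearMap.proj i ∘ₗ (ZInf O n).subtype
  have hg : ∀ z, g z = (z : Fin n → SymKronecker O) i • a • x := fun z => rfl
  have hχg : χ g = if i = l then c0 a * c0Div hε l (h x) else 0 := by
    apply mul_left_cancel₀ hε.ne_zero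
    rw [hχ, hg, coe_b1]
    split_ifs
    · rw [map_smul h, map_smul h, c0Div_smul, c0Div_smul, c0_algebraMap]
    · simp
  have hleft : cXY (a * (piInf ε hε ((LinearMap.pi fun j =>
      frobeniusLift (χ ∘ₗ s ∘ₗ LinearMap.single O (fun _ => L) j)) x) :
      Fin n → SymKronecker O) i) = χ g := by
    rw [piInf_eq_sum]
    have hsum : ev g = ∑ j, Pi.single j (g (piInfGen ε hε j)) :=
      (Finset.univ_sum_single (ev g)).symm
    rw [← hs g, hsum, map_sum, map_sum]
    simp only [Submodule.coe_sum, Finset.sum_apply, Submodule.coe_smul, Pi.smul_apply,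
      smul_eq_mul, Finset.mul_sum, map_sum, LinearMap.pi_apply]
    refine Finset.sum_congr rfl fun j _ => ?_
    have hcomm : ∀ F P : SymKronecker O, a * (P * F) = (F * a) * P := fun F P => by ring
    rw [hcomm, cXY_mul_frobeniusLift, hg, mul_smul]
    rfl
  rw [hleft, hχg]
  change _ = cXY (a * c0Div hε l (h x) • ((b4 l : ZInf O n) : Fin n → SymKronecker O) i)
  rw [coe_b4]
  split_ifs <;> simp [mul_comm]

/-- With β = `betaCoeff (N (b1 ε hε k))`, two families of congruences (`hb` and `hG`) carry cY(β_k)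
≡ 0 from each k to the next; at the last index, `hb` demands cY(β_l) ≡ -1. -/
theorem not_exists_lift_phi (l : Fin n) (hl : l.val + 1 = n) :
    ¬ ∃ N : ZInf O n →ₗ[SymKronecker O] (Fin (2 * n) → SymKronecker O),
      ∀ x, piInf ε hε (N x) = phiInf hε l x := by
  rintro ⟨N, hN⟩
  -- XY coordinate of π(N b_{k,1}) = Φ(b_{k,1}) at index i.
  have hb : ∀ k i, ε ∣ cX (nxt (betaCoeff (N (b1 ε hε k))) i) - cY (betaCoeff (N (b1 ε hε k)) i) -
      (if i = l ∧ l = k then 1 else 0) := by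
    intro k i
    have h := congrArg (fun z : ZInf O n => cXY ((z : Fin n → SymKronecker O) i)) (hN (b1 ε hε k))
    change _ = cXY (c0Div hε l (b1 ε hε k) • ((b4 l : ZInf O n) : Fin n → SymKronecker O) i) at h
    rw [c0Div_b1, coe_b4] at h
    simp only [piInf_apply, map_sub, map_add, cXY_mul, c0_algebraMap, cX_algebraMap,
      cY_algebraMap, cXY_algebraMap, c0_X, cX_X, cY_X, cXY_X, c0_Y, cX_Y, cY_Y, cXY_Y,
      zero_mul, add_zero, zero_add, one_mul] at h
    refine ⟨-cXY (alphaCoeff (N (b1 ε hε k)) i), ?_⟩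
    have h' : cXY ((if l = k then (1 : O) else 0) •
        if i = l then X O * Y O else 0) = if i = l ∧ l = k then 1 else 0 := by
      by_cases h2 : l = k
      · subst h2; split_ifs <;> simp_all
      · simp [h2]
    rw [h'] at h
    rw [← h]
    ring
  -- XY coordinate of ε β(N(bG k)) = Y β(N b_{k-1,1}) - X β(N b_{k,1}).
  have hG : ∀ k i, ε ∣ prv (fun k => cX (betaCoeff (N (b1 ε hε k)) i)) k -
      cY (betaCoeff (N (b1 ε hε k)) i) := by
    intro k i
    have h := congrArg (fun p => cXY (p i)) (eps_smul_map_bG hε (betaCoeff ∘ₗ N) k)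
    have hp : (prv (fun k => (betaCoeff ∘ₗ N) (b1 ε hε k)) k) i =
      prv (fun k => betaCoeff (N (b1 ε hε k)) i) k := by
      unfold prv; split_ifs <;> rfl
    refine ⟨cXY (betaCoeff (N (bG k)) i), ?_⟩
    rw [← map_prv cX, ← hp]
    simpa using h.symm
  have key : ∀ m (hm : m < n), ε ∣ cY (betaCoeff (N (b1 ε hε ⟨m, hm⟩)) ⟨m, hm⟩) := by
    intro m
    induction m with
    | zero =>
      intro hm
      simpa [prv_zero] using hG ⟨0, hm⟩ ⟨0, hm⟩
    | succ m ih =>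
      intro hm
      have h1 := hG ⟨m + 1, hm⟩ ⟨m + 1, hm⟩
      have h2 := hb ⟨m, by omega⟩ ⟨m, by omega⟩
      have hml : ¬ (⟨m, by omega⟩ : Fin n) = l := fun h => by
        have := congrArg Fin.val h
        simp only at this
        omega
      rw [nxt_of_lt _ (j := ⟨m + 1, hm⟩) rfl, if_neg (fun h => hml h.1), sub_zero] at h2
      rw [prv_of_lt _ (i := ⟨m, by omega⟩) rfl] at h1
      exact (dvd_sub_right ((dvd_sub_left (ih (by omega))).1 h2)).1 h1
  have h1 := hb l l
  rw [nxt_last _ hl, map_zero, if_pos ⟨rfl, rfl⟩, zero_sub] at h1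
  have h2 := (dvd_sub_right ((dvd_neg).2 (key l l.2))).1 h1
  exact hε.not_isUnit (isUnit_of_dvd_one h2)

end Factorization

/-! ### The pull-back sequence is almost split -/

theorem proposition4 (O : Type u) [CommRing O] [IsDomain O] [IsDiscreteValuationRing O]
    [IsAdicComplete (maximalIdeal O) O] [IsAlgClosed (ResidueField O)]
    (ε : O) (hε : Irreducible ε) (n : ℕ) (hn : 0 < n) :
    (∃! Φ : ZInf O n →ₗ[SymKronecker O] ZInf O n, IsPhiInf ε hε Φ) ∧
    Function.Surjective (piInf (n := n) ε hε) ∧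
    (∃ ι : ZInf O n →ₗ[SymKronecker O] (Fin (2 * n) → SymKronecker O),
      Function.Injective ι ∧ Function.Exact ι (piInf ε hε)) ∧
    ∀ Φ : ZInf O n →ₗ[SymKronecker O] ZInf O n, IsPhiInf ε hε Φ →
      ∀ (ι : ZInf O n →ₗ[SymKronecker O] (Fin (2 * n) → SymKronecker O))
        (_ : Function.Injective ι) (hι : Function.Exact ι (piInf ε hε)),
        IsAlmostSplit O (SymKronecker O) (ZInf O n) (pullback (piInf ε hε) Φ) (ZInf O n)
          (pullbackInl (piInf ε hε) Φ ι hι.linearMap_comp_eq_zero)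
          (pullbackSnd (piInf ε hε) Φ) := by
  let l : Fin n := ⟨n - 1, by omega⟩
  have hl : l.val + 1 = n := by simp only [l]; omega
  have hΨ := isPhiInf_phiInf hε hl
  refine ⟨⟨phiInf hε l, hΨ, fun Φ hΦ => hΦ.eq hε hΨ⟩, surjective_piInf hε,
    exists_exact_piInf hε, fun Φ hΦ ι hιinj hι => ?_⟩
  obtain rfl := hΦ.eq hε hΨ
  have hZ : IsLattice O (ZInf O n) := isLattice_ZInf
  have hloc : HasLocalEnd (SymKronecker O) (ZInf O n) := hasLocalEnd_ZInf hn
  have : Nontrivial (ZInf O n) := by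
    refine ⟨b1 ε hε l, 0, fun h => ?_⟩
    have := c0Div_b1 hε l l
    rw [h, map_zero, if_pos rfl] at this
    exact zero_ne_one this
  have hmem : ∀ x : pullback (piInf ε hε) (phiInf hε l),
      piInf ε hε x.1.1 = phiInf hε l x.1.2 := fun x => x.2
  have hE : IsLattice O (pullback (piInf ε hε) (phiInf hε l)) := by
    have := hZ.finite
    have : Module.Finite O (pullback (piInf ε hε) (phiInf hε l)) :=
      inferInstanceAs (Module.Finite O ((pullback (piInf ε hε) (phiInf hε l)).restrictScalars O))
    refine isLattice_of_isTorsionFree _ fun r x hr hx => ?_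
    have h1 : r • x.1.1 = 0 := congrArg Prod.fst (congrArg Subtype.val hx)
    have h2 : r • x.1.2 = 0 := congrArg Prod.snd (congrArg Subtype.val hx)
    refine Subtype.ext (Prod.ext (funext fun j => ?_) (hZ.eq_zero_of_smul_eq_zero hr h2))
    apply epsA_mul_cancel hr
    rw [← Algebra.smul_def]
    exact (congrFun h1 j).trans (mul_zero _).symm
  have hinj : Function.Injective
      (pullbackInl (piInf ε hε) (phiInf hε l) ι hι.linearMap_comp_eq_zero) := fun x y hxy =>
    hιinj (congrArg Prod.fst (congrArg Subtype.val hxy))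
  have hsurj : Function.Surjective (pullbackSnd (piInf ε hε) (phiInf hε l)) := fun z => by
    obtain ⟨p, hp⟩ := surjective_piInf hε (phiInf hε l z)
    exact ⟨⟨(p, z), hp⟩, rfl⟩
  have hex : Function.Exact (pullbackInl (piInf ε hε) (phiInf hε l) ι hι.linearMap_comp_eq_zero)
      (pullbackSnd (piInf ε hε) (phiInf hε l)) := by
    refine fun x => ⟨fun hx => ?_, ?_⟩
    · have hx' : x.1.2 = 0 := hx
      obtain ⟨z, hz⟩ := (hι x.1.1).1 (by rw [hmem, hx', map_zero])
      exact ⟨z, Subtype.ext (Prod.ext hz hx'.symm)⟩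
    · rintro ⟨z, rfl⟩
      rfl
  have hns : ¬ IsRetractionMap (A := SymKronecker O)
      (M := pullback (piInf ε hε) (phiInf hε l)) (N := ZInf O n)
      (pullbackSnd (piInf ε hε) (phiInf hε l)) := by
    rintro ⟨s, hs⟩
    -- The A²ⁿ component of a section would lift Φ through π.
    refine not_exists_lift_phi hε l hl ⟨LinearMap.fst _ _ _ ∘ₗ Submodule.subtype _ ∘ₗ s,
      fun x => (hmem (s x)).trans (congrArg _ (LinearMap.congr_fun hs x))⟩
  have hfac : FactorsNonRetractions (A := SymKronecker O)
      (E := pullback (piInf ε hε) (phiInf hε l)) (W := ZInf O n) O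
      (pullbackSnd (piInf ε hε) (phiInf hε l)) := by
    intro L _ _ _ _ hL h hh
    obtain ⟨N, hN⟩ := exists_lift_phi hε hL h l fun g => by
      -- A unit diagonal entry would make h ∘ g bijective, and h a retraction.
      by_contra hnd
      obtain ⟨v, -, hv⟩ := exists_inverse_of_bijective (bijective_of_not_dvd hε (h ∘ₗ g) l hnd)
      exact hh ⟨g ∘ₗ v, LinearMap.ext hv⟩
    exact ⟨(N.prod h).codRestrict _ hN, fun x => rfl⟩
  exact
    { lattice_left := hZ
      lattice_middle := hE
      lattice_right := hZ
      injective := hinj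
      exact := hex
      surjective := hsurj
      irreducible_left := isIrreducibleInLatt_left hE hZ hex hinj hsurj hns hloc hloc hfac
      irreducible_right := isIrreducibleInLatt_right hex hinj hsurj hns hloc hfac
      indecomposable_left := hloc.isIndecomposableModule
      indecomposable_right := hloc.isIndecomposableModule }
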